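/- Let $d\ge 1$, let $\Omega\subseteq[0,1]^d$ be a measurable set of positive Lebesgue measure, and let $s>0$, $L>0$, $b_2>0$, $b_3\ge 0$. Consider the repeated measurements model $$Y_{ij}=Z_i(X_{ij})+\epsilon_{ij}=f^\circ(X_{ij})+U_i(X_{ij})+\epsilon_{ij},\qquad 1\le i\le n,\ 1\le j\le m,$$ where $Z_1,\dots,Z_n$ are i.i.d. random functions with continuous sample paths on $\Omega$, $f^\circ(x)=\mathbb E[Z_1(x)]$ is the regression function, $U_i=Z_i-f^\circ$, the design points $X_{ij}$ are i.i.d. with the uniform distribution $\mathcal P_X$ on $\Omega$, the noise variables $\epsilon_{ij}$ are independent with mean zero, and the $X_{ij}$, the $Z_i$ and the $\epsilon_{ij}$ are independent of each other. For $f:\Omega\to\mathbb R$ let $$\|f\|_{\mathcal C^s}=\sum_{|\alpha|<s}\|\partial^\alpha f\|_\infty+\sum_{|\alpha|=\lfloor s\rfloor}\ \sup_{x\ne x'\in\Omega}\frac{|\partial^\alpha f(x)-\partial^\alpha f(x')|}{\|x-x'\|^{s-\lfloor s\rfloor}}$$ be the $s$-Hölder norm, with $\lfloor s\rfloor$ the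 largest integer strictly smaller than $s$. Let $\mathcal Q$ be the set of all joint distributions $\mathcal P_{Z,\epsilon}$ of the random functions and the noise, as above, for which $\|f^\circ\|_{\mathcal C^s}\le L$ and, for all $i,j$, $$\mathbb E\exp\bigl(|U_i(X_{ij})|/b_2\bigr)\le 2,\qquad \mathbb E\exp\bigl(|\epsilon_{ij}|/b_3\bigr)\le 2,$$ where for $b_3=0$ the last condition means that $\epsilon_{ij}=0$ almost surely. Then there is a constant $c>0$, not depending on $n$ and $m$, such that for all $n,m\ge 1$ with $nm\ge 3$ $$\inf_{\tilde f}\ \sup_{\mathcal P_{Z,\epsilon}\in\mathcal Q}\ \mathbb E\left[\int_\Omega\bigl(\tilde f(x)-f^\circ(x)\bigr)^2\,d\mathcal P_X(x)\right]\ \ge\ c\left(n^{-1}+(nm)^{-\frac{2s}{2s+d}}\right),$$ where the infimum is over all (measurable) estimators $\tilde f$ based on the data $\{(X_{ij},Y_{ij}):1\le i\le n,\ 1\le j\le m\}$. -/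

import Mathlib

open MeasureTheory ProbabilityTheory
open scoped ENNReal

noncomputable section

namespace RepeatedMeasurements

/-- `ℝ^d` with the Euclidean norm. -/
abbrev Space (d : ℕ) : Type := EuclideanSpace ℝ (Fin d)

/-- The cube `[0,1]^d`. -/
def unitCube (d : ℕ) : Set (Space d) := {x | ∀ i, x i ∈ Set.Icc (0 : ℝ) 1}

/-! ### Hölder balls -/

/-- The largest integer strictly smaller than `s` (for `s > 0`). -/
def strictFloor (s : ℝ) : ℕ := ⌈s⌉₊ - 1

/-- `g` is a family of partial derivatives `g α = ∂^α f` of `f : Ω → ℝ`, for all multi-indices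
of order at most `k`. Only the values of `g α` on `Ω` matter. When `Ω` is open, or is contained in
the closure of its interior and the `g α` are continuous on `Ω`, the family is determined by `f`. -/
structure IsPartialDerivFamily {d : ℕ} (Ω : Set (Space d)) (k : ℕ) (f : Ω → ℝ)
    (g : (Fin d → ℕ) → Space d → ℝ) : Prop where
  zero : ∀ x : Ω, g 0 x = f x
  deriv : ∀ α : Fin d → ℕ, ∑ i, α i < k → ∀ x ∈ Ω,
    HasFDerivWithinAt (g α)
      (∑ i, g (α + Pi.single i 1) x • (EuclideanSpace.proj i : Space d →L[ℝ] ℝ)) Ω x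

/-- The `s`-Hölder norm on `Ω` in terms of the family `g α = ∂^α f` : the sum of the supremum norms
of `∂^α f` over `|α| < s`, plus the sum over `|α| = ⌊s⌋` of the Hölder seminorms of `∂^α f` with
exponent `s - ⌊s⌋`, where `⌊s⌋` is the largest integer strictly smaller than `s`. -/
def holderNorm {d : ℕ} (Ω : Set (Space d)) (s : ℝ) (g : (Fin d → ℕ) → Space d → ℝ) : ℝ≥0∞ :=
  (∑ l ∈ Finset.range (strictFloor s + 1), ∑ α ∈ Finset.piAntidiag (Finset.univ : Finset (Fin d)) l,
      ⨆ x ∈ Ω, ENNReal.ofReal |g α x|) +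
    ∑ α ∈ Finset.piAntidiag (Finset.univ : Finset (Fin d)) (strictFloor s),
      ⨆ x ∈ Ω, ⨆ y ∈ Ω, ⨆ _ : x ≠ y,
        ENNReal.ofReal (|g α x - g α y| / ‖x - y‖ ^ (s - strictFloor s))

/-- `f ∈ C^s(Ω)` with `‖f‖_{C^s} ≤ L`. -/
def InHolderBall {d : ℕ} (Ω : Set (Space d)) (s L : ℝ) (f : Ω → ℝ) : Prop :=
  ∃ g : (Fin d → ℕ) → Space d → ℝ,
    IsPartialDerivFamily Ω (strictFloor s) f g ∧ holderNorm Ω s g ≤ ENNReal.ofReal L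

/-! ### The model -/

/-- The uniform distribution on `Ω`. -/
def uniformLaw {d : ℕ} (Ω : Set (Space d)) : Measure Ω :=
  (volume Ω)⁻¹ • Measure.comap ((↑) : Ω → Space d) volume

/-- Continuous sample paths on `Ω`; its measurable structure is the one
generated by the evaluations `z ↦ z x`, `x ∈ Ω`. -/
abbrev PathSpace {d : ℕ} (Ω : Set (Space d)) : Type := {z : Ω → ℝ // Continuous z}

/-- The distribution of the random part of the model: `pathLaw` is the common law of the i.i.d.
random functions `Z₁, …, Zₙ`, and `noiseLaw i j` is the law of `ε_{ij}`. The `ε_{ij}` are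
independent of each other and of the `Z_i`, so these laws determine the joint law. -/
structure Law {d : ℕ} (n m : ℕ) (Ω : Set (Space d)) where
  pathLaw : ProbabilityMeasure (PathSpace Ω)
  noiseLaw : Fin n → Fin m → ProbabilityMeasure ℝ

/-- The regression function `f°(x) = E[Z(x)] = E[Z(X) | X = x]`. -/
def Law.mean {d n m : ℕ} {Ω : Set (Space d)} (Q : Law n m Ω) (x : Ω) : ℝ :=
  ∫ z, z.1 x ∂(Q.pathLaw : Measure (PathSpace Ω))

/-- The random variable `V` is sub-exponential with parameter `b ≥ 0`: `E exp(|V| / b) ≤ 2`,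
which for `b = 0` means that `V` vanishes almost surely. -/
def IsSubExp {S : Type*} [MeasurableSpace S] (μ : Measure S) (V : S → ℝ) (b : ℝ) : Prop :=
  (b = 0 → ∀ᵐ ω ∂μ, V ω = 0) ∧
    (b ≠ 0 → ∫⁻ ω, ENNReal.ofReal (Real.exp (|V ω| / b)) ∂μ ≤ 2)

/-- The class of admissible distributions for the uniform design on `Ω`: the mean function exists
and lies in the ball of radius `L` of `C^s(Ω)`, `U_i(X_{ij}) = Z_i(X_{ij}) - f°(X_{ij})` is
sub-exponential with parameter `b₂`, and the `ε_{ij}` are centred and sub-exponential with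
parameter `b₃`. -/
structure Law.Admissible {d n m : ℕ} {Ω : Set (Space d)} (Q : Law n m Ω) (s L b₂ b₃ : ℝ) :
    Prop where
  integrable : ∀ x : Ω, Integrable (fun z : PathSpace Ω => z.1 x) (Q.pathLaw : Measure _)
  holder : InHolderBall Ω s L Q.mean
  process : IsSubExp ((Q.pathLaw : Measure (PathSpace Ω)).prod (uniformLaw Ω))
    (fun p => p.1.1 p.2 - Q.mean p.2) b₂
  noise_mean : ∀ i j, ∫ e, e ∂(Q.noiseLaw i j : Measure ℝ) = 0
  noise : ∀ i j, IsSubExp (Q.noiseLaw i j : Measure ℝ) (fun e => e) b₃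

/-- Data sets `(X_{ij}, Y_{ij})`, `i < n`, `j < m`. -/
abbrev DataSet {d : ℕ} (n m : ℕ) (Ω : Set (Space d)) : Type := Fin n → Fin m → Ω × ℝ

/-- Estimators of a function on `Ω`: (jointly) measurable functions of the data and the point. -/
abbrev Estimator {d : ℕ} (n m : ℕ) (Ω : Set (Space d)) : Type :=
  {f : DataSet n m Ω → Ω → ℝ // Measurable (Function.uncurry f)}

/-- The underlying sample space: design points, random functions, noise variables. -/
abbrev SampleSpace {d : ℕ} (n m : ℕ) (Ω : Set (Space d)) : Type :=
  (Fin n → Fin m → Ω) × (Fin n → PathSpace Ω) × (Fin n → Fin m → ℝ)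

/-- The observed data `Y_{ij} = Z_i(X_{ij}) + ε_{ij}`. -/
def observe {d n m : ℕ} {Ω : Set (Space d)} (ω : SampleSpace n m Ω) : DataSet n m Ω :=
  fun i j => (ω.1 i j, (ω.2.1 i).1 (ω.1 i j) + ω.2.2 i j)

/-- The joint law of the design points, the random functions and the noise, all independent. -/
def Law.sampleLaw {d n m : ℕ} {Ω : Set (Space d)} (Q : Law n m Ω) :
    Measure (SampleSpace n m Ω) :=
  (Measure.pi fun _ : Fin n => Measure.pi fun _ : Fin m => uniformLaw Ω).prod
    ((Measure.pi fun _ : Fin n => (Q.pathLaw : Measure (PathSpace Ω))).prod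
      (Measure.pi fun i : Fin n => Measure.pi fun j : Fin m => (Q.noiseLaw i j : Measure ℝ)))

/-- The mean squared prediction error `E ∫_Ω (f̃ - f°)² dP_X`. -/
def Law.predictionError {d n m : ℕ} {Ω : Set (Space d)} (Q : Law n m Ω)
    (f : Estimator n m Ω) : ℝ≥0∞ :=
  ∫⁻ ω, ∫⁻ x, ENNReal.ofReal ((f.1 (observe ω) x - Q.mean x) ^ 2) ∂(uniformLaw Ω) ∂Q.sampleLaw

end RepeatedMeasurements

end

noncomputable section

namespace RepeatedMeasurements

/-! ### Product measures with densities -/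

/-! The measurement errors can be taken to vanish: the random functions alone force both rates. Let
`Z = f + ∑ₗ wₗ ηₗ` with i.i.d. `ηₗ` of density `ψ²` supported in `[-a, a]`, `a = b₂ log 2`, and
continuous profiles with `∑ₗ |wₗ| ≤ 1`. Then `|U| ≤ a`, hence `exp (|U| / b₂) ≤ 2`, and these laws
are admissible for every `b₃` (`noisyLaw_admissible`). The root density `ψ` is a tent, whose
Hellinger affinity with its translate by `h` is `1 - O(h²)`. Affinities multiply over independent
coordinates, which gives the two-point bound `IsRootDensity.two_point`: samples shifted by `α` and
by `β` are hard to tell apart when `∑ (αᵢ - βᵢ)²` is small.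

Rate `1/n`: with the single profile `w = 1`, row `i` carries only one noise variable, whatever `m`
is. The constant regression functions `± t / √n` are then indistinguishable
(`ofReal_div_le_maxError`).

Rate `(nm)^(-2s/(2s+d))`: here all `nm` observations should carry independent noise although the
paths are continuous. The profiles are plateaus on slabs of width `1/N` in one coordinate. For `N`
large, depending on `n` and `m`, with probability at least `3/4` every design point sees exactly one
noise variable with weight `1`, and no two points of a row share one (`exists_goodDesigns`). On such
designs the model is regression with independent errors. Assouad's argument then applies to sums of
bumps with free signs on cells of mesh `1/K`, `K ≍ (nm)^(1/(2s+d))` (`inHolderBall_bumpSum`,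
`pointError_flip`, `ofReal_rpow_le_maxError`). The bumps are smooth on all of `ℝ^d` and flat on most
of each cell, so of `Ω` only its positive volume matters. -/

lemma lintegral_pi_prod_ofReal {ι : Type*} [Fintype ι] (p : ι → ℝ → ℝ) (hp : ∀ i x, 0 ≤ p i x)
    (hi : ∀ i, Integrable (p i)) :
    ∫⁻ y : ι → ℝ, ENNReal.ofReal (∏ i, p i (y i)) = ∏ i, ∫⁻ x, ENNReal.ofReal (p i x) := by
  rw [volume_pi, ← ofReal_integral_eq_lintegral_ofReal (Integrable.fintype_prod_dep hi)
    (Filter.Eventually.of_forall fun y => Finset.prod_nonneg fun i _ => hp i _),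
    integral_fintype_prod_eq_prod, ENNReal.ofReal_prod_of_nonneg
      (fun i _ => integral_nonneg (hp i))]
  exact Finset.prod_congr rfl fun i _ => ofReal_integral_eq_lintegral_ofReal (hi i)
    (Filter.Eventually.of_forall (hp i))

lemma pi_withDensity_ofReal {ι : Type*} [Fintype ι] (p : ι → ℝ → ℝ) (hp : ∀ i x, 0 ≤ p i x)
    (hi : ∀ i, Integrable (p i)) :
    Measure.pi (fun i => volume.withDensity fun x => ENNReal.ofReal (p i x)) =
      (volume : Measure (ι → ℝ)).withDensity fun y => ENNReal.ofReal (∏ i, p i (y i)) := by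
  have : ∀ i, IsFiniteMeasure (volume.withDensity fun x => ENNReal.ofReal (p i x)) := fun i =>
    isFiniteMeasure_withDensity_ofReal (hi i).2
  refine Measure.pi_eq fun s hs => ?_
  rw [withDensity_apply _ (MeasurableSet.univ_pi hs), ← lintegral_indicator (MeasurableSet.univ_pi hs)]
  have h1 : ∀ y : ι → ℝ, (Set.univ.pi s).indicator (fun y => ENNReal.ofReal (∏ i, p i (y i))) y =
      ENNReal.ofReal (∏ i, (s i).indicator (p i) (y i)) := by
    intro y
    by_cases hy : y ∈ Set.univ.pi s
    · rw [Set.indicator_of_mem hy]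
      congr 1
      exact Finset.prod_congr rfl fun i _ => (Set.indicator_of_mem (hy i trivial) _).symm
    · rw [Set.indicator_of_notMem hy]
      simp only [Set.mem_pi, Set.mem_univ, true_imp_iff, not_forall] at hy
      obtain ⟨i, hi⟩ := hy
      rw [Finset.prod_eq_zero (Finset.mem_univ i) (Set.indicator_of_notMem hi _),
        ENNReal.ofReal_zero]
  simp_rw [h1]
  rw [lintegral_pi_prod_ofReal (fun i => (s i).indicator (p i)) (fun i x => Set.indicator_nonneg (fun x _ => hp i x) x)
    (fun i => (hi i).indicator (hs i))]
  refine Finset.prod_congr rfl fun i _ => ?_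
  rw [withDensity_apply _ (hs i), ← lintegral_indicator (hs i)]
  refine lintegral_congr fun x => ?_
  by_cases hx : x ∈ s i <;> simp [hx]

/-- Weierstrass' product inequality. -/
lemma one_le_prod_add_sum {ι : Type*} (s : Finset ι) (r : ι → ℝ) (h0 : ∀ i ∈ s, 0 ≤ r i)
    (h1 : ∀ i ∈ s, r i ≤ 1) : 1 ≤ ∏ i ∈ s, r i + ∑ i ∈ s, (1 - r i) := by
  classical
  induction s using Finset.induction_on with
  | empty => simp
  | insert a s ha ih =>
    rw [Finset.prod_insert ha, Finset.sum_insert ha]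
    have h2 := ih (fun i hi => h0 i (Finset.mem_insert_of_mem hi))
      (fun i hi => h1 i (Finset.mem_insert_of_mem hi))
    have ha0 := h0 a (Finset.mem_insert_self a s)
    have ha1 := h1 a (Finset.mem_insert_self a s)
    have hp1 : ∏ i ∈ s, r i ≤ 1 := Finset.prod_le_one
      (fun i hi => h0 i (Finset.mem_insert_of_mem hi))
      (fun i hi => h1 i (Finset.mem_insert_of_mem hi))
    nlinarith

/-! ### The noise distribution -/

/-- `ψ` is the square root of a symmetric probability density on `[-a, a]` whose Hellinger
affinity with its translates is `1 - O(h²)`. -/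
structure IsRootDensity (ψ : ℝ → ℝ) (a C : ℝ) : Prop where
  continuous : Continuous ψ
  nonneg : ∀ u, 0 ≤ ψ u
  even : ∀ u, ψ (-u) = ψ u
  zero : ∀ u, a < |u| → ψ u = 0
  norm : ∫ u, ψ u ^ 2 = 1
  affinity : ∀ h, 1 ≤ (∫ u, ψ u * ψ (u - h)) + C * h ^ 2

/-- The normalised tent works. It is 1-Lipschitz, and its difference with a translate by `h` lives
on two intervals of length `2a`, so the squared `L²` distance is at most `4ah²`. Expanding the
square turns this into the affinity bound with `C = 2a / I`, where `I` is the squared norm of the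
tent. -/
lemma exists_isRootDensity {a : ℝ} (ha : 0 < a) : ∃ ψ C, 0 < C ∧ IsRootDensity ψ a C := by
  set τ : ℝ → ℝ := fun u => max 0 (a - |u|) with hτ
  have τc : Continuous τ := by fun_prop
  have τ0 : ∀ u, 0 ≤ τ u := fun u => le_max_left _ _
  have τz : ∀ u, a ≤ |u| → τ u = 0 := fun u hu => max_eq_left (by linarith)
  have τs : HasCompactSupport τ := HasCompactSupport.of_support_subset_isCompact
    (isCompact_Icc (a := -a) (b := a)) fun u hu => by
      by_contra h
      refine hu (τz u ?_)
      rw [Set.mem_Icc, ← abs_le] at h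
      linarith
  have τsh : ∀ h, HasCompactSupport fun u => τ (u - h) := fun h =>
    τs.comp_homeomorph (Homeomorph.subRight h)
  have τl : ∀ u h, |τ u - τ (u - h)| ≤ |h| := by
    intro u h
    have h1 : |τ u - τ (u - h)| ≤ |(a - |u|) - (a - |u - h|)| := by
      simpa [hτ] using abs_max_sub_max_le_max 0 (a - |u|) 0 (a - |u - h|)
    refine h1.trans ?_
    have h2 := abs_abs_sub_abs_le (u - h) u
    rw [show (a - |u|) - (a - |u - h|) = |u - h| - |u| by ring]
    refine h2.trans (le_of_eq ?_)
    rw [show u - h - u = -h by ring, abs_neg]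
  have i2 : ∀ h k, Integrable fun u => τ (u - h) * τ (u - k) := fun h k =>
    Continuous.integrable_of_hasCompactSupport (by fun_prop) (HasCompactSupport.mul_right (τsh h))
  have isq : ∀ h, Integrable fun u => τ (u - h) ^ 2 := fun h => by
    simpa [sq] using i2 h h
  set I := ∫ u, τ u ^ 2 with hI
  have I0 : 0 < I := by
    have := isq 0
    simp only [sub_zero] at this
    refine (integral_pos_iff_support_of_nonneg (fun u => sq_nonneg _) this).2 ?_
    have hsub : Set.Ioo (0 : ℝ) a ⊆ Function.support fun u => τ u ^ 2 := by
      intro u hu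
      have : 0 < τ u := lt_max_of_lt_right (by rw [abs_of_pos hu.1]; linarith [hu.2])
      exact (pow_pos this 2).ne'
    refine lt_of_lt_of_le ?_ (measure_mono hsub)
    simpa using ha
  have Ish : ∀ h, ∫ u, τ (u - h) ^ 2 = I := fun h =>
    integral_sub_right_eq_self (fun u => τ u ^ 2) h
  have key : ∀ h, 2 * I - 2 * ∫ u, τ u * τ (u - h) ≤ 4 * a * h ^ 2 := by
    intro h
    have e1 : ∫ u, (τ u - τ (u - h)) ^ 2 = 2 * I - 2 * ∫ u, τ u * τ (u - h) := by
      have h1 := isq 0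
      have h2 := isq h
      have h3 := i2 0 h
      simp only [sub_zero] at h1 h3
      have : ∀ u, (τ u - τ (u - h)) ^ 2 = (τ u ^ 2 + τ (u - h) ^ 2) - 2 * (τ u * τ (u - h)) :=
        fun u => by ring
      simp_rw [this]
      rw [integral_sub (by exact h1.add h2) (h3.const_mul 2), integral_add h1 h2, integral_const_mul, Ish h]
      ring
    rw [← e1]
    have hb : ∀ u, (τ u - τ (u - h)) ^ 2 ≤ (Set.Icc (-a) a).indicator (fun _ => h ^ 2) u +
        (Set.Icc (h - a) (h + a)).indicator (fun _ => h ^ 2) u := by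
      intro u
      have hsq : (τ u - τ (u - h)) ^ 2 ≤ h ^ 2 := sq_le_sq.2 (τl u h)
      by_cases h1 : u ∈ Set.Icc (-a) a
      · rw [Set.indicator_of_mem h1]
        have := Set.indicator_nonneg (s := Set.Icc (h - a) (h + a)) (f := fun _ => h ^ 2)
          (fun _ _ => sq_nonneg h) u
        linarith
      by_cases h2 : u ∈ Set.Icc (h - a) (h + a)
      · rw [Set.indicator_of_mem h2, Set.indicator_of_notMem h1]
        linarith
      · rw [Set.indicator_of_notMem h1, Set.indicator_of_notMem h2]
        rw [Set.mem_Icc, ← abs_le] at h1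
        have h3 : ¬ |u - h| ≤ a := fun h4 => h2 ⟨by linarith [(abs_le.1 h4).1],
          by linarith [(abs_le.1 h4).2]⟩
        rw [τz u (by linarith), τz (u - h) (by linarith)]
        simp
    have j : ∀ x y : ℝ, Integrable ((Set.Icc x y).indicator fun _ => h ^ 2) := fun x y =>
      (integrable_indicator_iff measurableSet_Icc).2 (by simp)
    refine (integral_mono_of_nonneg (Filter.Eventually.of_forall fun u => sq_nonneg _)
      ((j _ _).add (j _ _)) (Filter.Eventually.of_forall hb)).trans ?_
    rw [Pi.add_def, integral_add (j _ _) (j _ _), integral_indicator measurableSet_Icc,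
      integral_indicator measurableSet_Icc]
    simp only [integral_const, smul_eq_mul, measureReal_restrict_apply_univ, Real.volume_real_Icc]
    rw [max_eq_left (by linarith), max_eq_left (by linarith)]
    linarith [sq_nonneg h]
  have hs := Real.sq_sqrt I0.le
  have hs0 : 0 < Real.sqrt I := Real.sqrt_pos.2 I0
  refine ⟨fun u => τ u / Real.sqrt I, 2 * a / I, by positivity, ⟨by fun_prop, fun u => by
    have := τ0 u; positivity, fun u => by simp [hτ], fun u hu => by rw [τz u hu.le, zero_div],
    ?_, fun h => ?_⟩⟩
  · simp_rw [div_pow, hs]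
    rw [integral_div, div_self I0.ne']
  · have : ∀ u, τ u / Real.sqrt I * (τ (u - h) / Real.sqrt I) = τ u * τ (u - h) / I := by
      intro u
      rw [div_mul_div_comm, ← sq, hs]
    simp_rw [this]
    rw [integral_div, div_mul_eq_mul_div, ← add_div, one_le_div I0]
    linarith [key h]

/-! ### Translates of the noise density, Hellinger affinity and the two-point bound -/

namespace IsRootDensity

variable {ψ : ℝ → ℝ} {a C : ℝ}

lemma hasCompactSupport (hψ : IsRootDensity ψ a C) : HasCompactSupport ψ :=
  HasCompactSupport.of_support_subset_isCompact (isCompact_Icc (a := -a) (b := a)) fun u hu => by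
    by_contra h
    refine hu (hψ.zero u ?_)
    rw [Set.mem_Icc, ← abs_le] at h
    linarith

lemma integrable_mul_shift (hψ : IsRootDensity ψ a C) (x y : ℝ) :
    Integrable fun u => ψ (u - x) * ψ (u - y) := by
  have := hψ.continuous
  exact Continuous.integrable_of_hasCompactSupport (by fun_prop) (HasCompactSupport.mul_right
    (hψ.hasCompactSupport.comp_homeomorph (Homeomorph.subRight x)))

lemma integrable_sq_shift (hψ : IsRootDensity ψ a C) (x : ℝ) :
    Integrable fun u => ψ (u - x) ^ 2 := by
  simpa [sq] using hψ.integrable_mul_shift x x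

lemma integrable_sq (hψ : IsRootDensity ψ a C) : Integrable fun u => ψ u ^ 2 := by
  simpa using hψ.integrable_sq_shift 0

lemma integral_sq_shift (hψ : IsRootDensity ψ a C) (x : ℝ) : ∫ u, ψ (u - x) ^ 2 = 1 :=
  (integral_sub_right_eq_self (fun u => ψ u ^ 2) x).trans hψ.norm

lemma affinity_shift (hψ : IsRootDensity ψ a C) (x y : ℝ) :
    1 - ∫ u, ψ (u - x) * ψ (u - y) ≤ C * (x - y) ^ 2 := by
  have h1 := hψ.affinity (y - x)
  rw [← integral_sub_right_eq_self (fun u => ψ u * ψ (u - (y - x))) x] at h1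
  simp only [sub_sub, add_sub_cancel] at h1
  linarith [show (x - y) ^ 2 = (y - x) ^ 2 by ring]

lemma affinity_le_one (hψ : IsRootDensity ψ a C) (x y : ℝ) :
    ∫ u, ψ (u - x) * ψ (u - y) ≤ 1 := by
  have h := integral_mono (hψ.integrable_mul_shift x y)
    (((hψ.integrable_sq_shift x).add (hψ.integrable_sq_shift y)).div_const 2) (fun u => by
      have := two_mul_le_add_sq (ψ (u - x)) (ψ (u - y))
      simp only [Pi.add_apply]
      linarith)
  rw [integral_div, Pi.add_def, integral_add (hψ.integrable_sq_shift x) (hψ.integrable_sq_shift y),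
    hψ.integral_sq_shift, hψ.integral_sq_shift] at h
  linarith

/-- The distribution with density `ψ²`. -/
def law (_ : IsRootDensity ψ a C) : Measure ℝ :=
  volume.withDensity fun u => ENNReal.ofReal (ψ u ^ 2)

lemma measurable_ofReal_sq (hψ : IsRootDensity ψ a C) :
    Measurable fun u => ENNReal.ofReal (ψ u ^ 2) :=
  (hψ.continuous.pow 2).measurable.ennreal_ofReal

instance isProbabilityMeasure_law (hψ : IsRootDensity ψ a C) : IsProbabilityMeasure hψ.law := ⟨by
  rw [law, withDensity_apply _ MeasurableSet.univ, Measure.restrict_univ,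
    ← ofReal_integral_eq_lintegral_ofReal hψ.integrable_sq
      (Filter.Eventually.of_forall fun u => sq_nonneg _), hψ.norm, ENNReal.ofReal_one]⟩

lemma ae_abs_le (hψ : IsRootDensity ψ a C) : ∀ᵐ u ∂hψ.law, |u| ≤ a := by
  rw [law, ae_withDensity_iff hψ.measurable_ofReal_sq]
  refine Filter.Eventually.of_forall fun u hu => ?_
  by_contra h
  exact hu (by rw [hψ.zero u (not_le.1 h)]; simp)

lemma integral_id_law (hψ : IsRootDensity ψ a C) : ∫ u, u ∂hψ.law = 0 := by
  rw [law, integral_withDensity_eq_integral_toReal_smul hψ.measurable_ofReal_sq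
    (Filter.Eventually.of_forall fun u => ENNReal.ofReal_lt_top)]
  simp only [smul_eq_mul, ENNReal.toReal_ofReal (sq_nonneg _)]
  have h := integral_neg_eq_self (fun u => ψ u ^ 2 * u) volume
  simp only [hψ.even, mul_neg, integral_neg] at h
  linarith

lemma integrable_id_law (hψ : IsRootDensity ψ a C) : Integrable (fun u => u) hψ.law :=
  Integrable.of_bound (by fun_prop) a (by simpa using hψ.ae_abs_le)

lemma lintegral_pi_law_shift (hψ : IsRootDensity ψ a C) {ι : Type*} [Fintype ι] (α : ι → ℝ)
    {F : (ι → ℝ) → ℝ≥0∞} (hF : Measurable F) :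
    ∫⁻ η, F (fun i => α i + η i) ∂Measure.pi (fun _ : ι => hψ.law) =
      ∫⁻ y : ι → ℝ, ENNReal.ofReal (∏ i, ψ (y i - α i) ^ 2) * F y := by
  have hc := hψ.continuous
  have h1 : Measure.pi (fun _ : ι => hψ.law) = _ :=
    pi_withDensity_ofReal (fun _ : ι => fun u => ψ u ^ 2) (fun _ _ => sq_nonneg _)
      (fun _ => hψ.integrable_sq)
  have hm : Measurable fun η : ι → ℝ => fun i => α i + η i := by fun_prop
  rw [h1, lintegral_withDensity_eq_lintegral_mul _ (by fun_prop) (by exact hF.comp hm),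
    ← lintegral_add_left_eq_self (fun y : ι → ℝ => ENNReal.ofReal (∏ i, ψ (y i - α i) ^ 2) * F y) α]
  refine lintegral_congr fun y => ?_
  simp [Pi.add_def]

/-- Two simple hypotheses: no statistic `T` of the sample `α + η`, `β + η` respectively can be close
to `h` under the first and close to `-h` under the second, if `α` and `β` are close. -/
theorem two_point (hψ : IsRootDensity ψ a C) {ι : Type*} [Fintype ι] (α β : ι → ℝ)
    {T : (ι → ℝ) → ℝ} (hT : Measurable T) (h : ℝ) :
    ENNReal.ofReal (2 * h ^ 2) ≤
      ∫⁻ η, ENNReal.ofReal ((T (fun i => α i + η i) - h) ^ 2) ∂Measure.pi (fun _ : ι => hψ.law) +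
      ∫⁻ η, ENNReal.ofReal ((T (fun i => β i + η i) + h) ^ 2) ∂Measure.pi (fun _ : ι => hψ.law) +
      ENNReal.ofReal (h ^ 2 / 2) + ENNReal.ofReal (2 * h ^ 2 * (C * ∑ i, (α i - β i) ^ 2)) := by
  have hc := hψ.continuous
  rw [hψ.lintegral_pi_law_shift α (F := fun y => ENNReal.ofReal ((T y - h) ^ 2)) (by fun_prop),
    hψ.lintegral_pi_law_shift β (F := fun y => ENNReal.ofReal ((T y + h) ^ 2)) (by fun_prop)]
  set p : (ι → ℝ) → ℝ := fun y => ∏ i, ψ (y i - α i)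
  set q : (ι → ℝ) → ℝ := fun y => ∏ i, ψ (y i - β i)
  have hp0 : ∀ y, 0 ≤ p y := fun y => Finset.prod_nonneg fun i _ => hψ.nonneg _
  have hq0 : ∀ y, 0 ≤ q y := fun y => Finset.prod_nonneg fun i _ => hψ.nonneg _
  have hpm : Continuous p := by fun_prop
  have hqm : Continuous q := by fun_prop
  simp_rw [Finset.prod_pow]
  have hmass : ∀ γ : ι → ℝ, ∫⁻ y : ι → ℝ, ENNReal.ofReal ((∏ i, ψ (y i - γ i)) ^ 2) = 1 := by
    intro γ
    simp_rw [← Finset.prod_pow]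
    rw [lintegral_pi_prod_ofReal (fun i u => ψ (u - γ i) ^ 2) (fun _ _ => sq_nonneg _)
      (fun i => hψ.integrable_sq_shift _)]
    refine Finset.prod_eq_one fun i _ => ?_
    rw [← ofReal_integral_eq_lintegral_ofReal (hψ.integrable_sq_shift _)
      (Filter.Eventually.of_forall fun u => sq_nonneg _), hψ.integral_sq_shift, ENNReal.ofReal_one]
  set r : ι → ℝ := fun i => ∫ u, ψ (u - α i) * ψ (u - β i)
  have hr0 : ∀ i, 0 ≤ r i := fun i => integral_nonneg fun u => mul_nonneg (hψ.nonneg _) (hψ.nonneg _)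
  have hr : ∫⁻ y, ENNReal.ofReal (p y * q y) = ENNReal.ofReal (∏ i, r i) := by
    simp_rw [p, q, ← Finset.prod_mul_distrib]
    rw [lintegral_pi_prod_ofReal (fun i u => ψ (u - α i) * ψ (u - β i))
      (fun _ _ => mul_nonneg (hψ.nonneg _) (hψ.nonneg _)) (fun i => hψ.integrable_mul_shift _ _),
      ENNReal.ofReal_prod_of_nonneg (fun i _ => hr0 i)]
    exact Finset.prod_congr rfl fun i _ => (ofReal_integral_eq_lintegral_ofReal
      (hψ.integrable_mul_shift _ _) (Filter.Eventually.of_forall fun u =>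
        mul_nonneg (hψ.nonneg _) (hψ.nonneg _))).symm
  -- The affinity of the product laws is `∏ rᵢ`; Weierstrass' inequality bounds its defect by the
  -- sum of the one-dimensional defects.
  have hprod : 1 ≤ ∏ i, r i + C * ∑ i, (α i - β i) ^ 2 := by
    refine (one_le_prod_add_sum Finset.univ r (fun i _ => hr0 i)
      (fun i _ => hψ.affinity_le_one _ _)).trans ?_
    rw [Finset.mul_sum]
    gcongr with i
    exact hψ.affinity_shift _ _
  have hpt : ∀ y, ENNReal.ofReal (2 * h ^ 2) * ENNReal.ofReal (p y * q y) ≤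
      ENNReal.ofReal (p y ^ 2) * ENNReal.ofReal ((T y - h) ^ 2) +
      ENNReal.ofReal (q y ^ 2) * ENNReal.ofReal ((T y + h) ^ 2) +
      ENNReal.ofReal (h ^ 2 / 4) * (ENNReal.ofReal (p y ^ 2) + ENNReal.ofReal (q y ^ 2)) := by
    intro y
    rw [← ENNReal.ofReal_mul (by positivity), ← ENNReal.ofReal_mul (by positivity),
      ← ENNReal.ofReal_mul (by positivity), ← ENNReal.ofReal_add (by positivity) (by positivity),
      ← ENNReal.ofReal_add (by positivity) (by positivity), ← ENNReal.ofReal_mul (by positivity),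
      ← ENNReal.ofReal_add (by positivity) (by positivity)]
    refine ENNReal.ofReal_le_ofReal ?_
    -- The cross terms of the two squares are `h (T - h) p q` and `-h (T + h) p q`, with sum `-2h² p
    -- q`, so `T` cancels. The weight `h / 2` keeps the price at `h²/4 (p² + q²)`, which integrates
    -- to `h²/2`.
    have hA := sq_nonneg ((T y - h) * p y + h / 2 * q y)
    have hB := sq_nonneg ((T y + h) * q y - h / 2 * p y)
    nlinarith
  have hint := lintegral_mono (μ := volume) hpt
  rw [lintegral_const_mul _ (by fun_prop), hr, lintegral_add_left (by fun_prop),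
    lintegral_add_left (by fun_prop), lintegral_const_mul _ (by fun_prop),
    lintegral_add_left (by fun_prop), hmass, hmass, ← ENNReal.ofReal_mul (by positivity)] at hint
  have e2 : ENNReal.ofReal (h ^ 2 / 4) * (1 + 1) = ENNReal.ofReal (h ^ 2 / 2) := by
    rw [one_add_one_eq_two, show (2 : ℝ≥0∞) = ENNReal.ofReal 2 by simp,
      ← ENNReal.ofReal_mul (by positivity)]
    congr 1
    ring
  rw [e2] at hint
  calc ENNReal.ofReal (2 * h ^ 2)
      ≤ ENNReal.ofReal (2 * h ^ 2 * ∏ i, r i + 2 * h ^ 2 * (C * ∑ i, (α i - β i) ^ 2)) := by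
        refine ENNReal.ofReal_le_ofReal ?_
        rw [← mul_add]
        exact le_mul_of_one_le_right (by positivity) hprod
    _ ≤ _ := ENNReal.ofReal_add_le.trans (by gcongr)

end IsRootDensity

/-! ### The uniform law -/

lemma volume_box {d : ℕ} (A : Fin d → Set ℝ) (hA : ∀ i, MeasurableSet (A i)) :
    volume {x : Space d | ∀ i, x i ∈ A i} = ∏ i, volume (A i) := by
  have h := (PiLp.volume_preserving_ofLp (ι := Fin d)).measure_preimage
    (MeasurableSet.univ_pi hA).nullMeasurableSet
  rw [volume_pi_pi] at h
  rw [← h]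
  congr 1
  ext x
  simp

lemma measurable_coord {d : ℕ} {Ω : Set (Space d)} (i : Fin d) :
    Measurable fun x : Ω => (x : Space d) i := by fun_prop

lemma measure_ne_top_of_subset_cube {d : ℕ} {Ω : Set (Space d)} (hcube : Ω ⊆ unitCube d) :
    volume Ω ≠ ∞ := by
  refine ((measure_mono hcube).trans_lt ?_).ne
  have := volume_box (d := d) (fun _ => Set.Icc 0 1) (fun _ => measurableSet_Icc)
  rw [unitCube, this]
  simp

lemma uniformLaw_apply {d : ℕ} {Ω : Set (Space d)} (hΩ : MeasurableSet Ω) (B : Set Ω) :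
    uniformLaw Ω B = (volume Ω)⁻¹ * volume ((↑) '' B : Set (Space d)) := by
  rw [uniformLaw, Measure.smul_apply, (MeasurableEmbedding.subtype_coe hΩ).comap_apply, smul_eq_mul]

lemma isProbabilityMeasure_uniformLaw {d : ℕ} {Ω : Set (Space d)} (hΩ : MeasurableSet Ω)
    (hcube : Ω ⊆ unitCube d) (hpos : 0 < volume Ω) : IsProbabilityMeasure (uniformLaw Ω) := ⟨by
  rw [uniformLaw_apply hΩ, Set.image_univ, Subtype.range_coe,
    ENNReal.inv_mul_cancel hpos.ne' (measure_ne_top_of_subset_cube hcube)]⟩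

/-- The density of the uniform law with respect to Lebesgue measure is at most `1 / vol Ω`, so the
volume of an enclosing box suffices and the shape of `Ω` plays no role. -/
lemma uniformLaw_box_le {d : ℕ} {Ω : Set (Space d)} (hΩ : MeasurableSet Ω)
    (hcube : Ω ⊆ unitCube d) (hpos : 0 < volume Ω) (B : Set Ω) (A : Fin d → Set ℝ)
    (hA : ∀ i, MeasurableSet (A i)) (hB : ∀ x ∈ B, ∀ i, (x : Space d) i ∈ A i) (c : Fin d → ℝ)
    (hc0 : ∀ i, 0 ≤ c i) (hc : ∀ i, volume (A i) ≤ ENNReal.ofReal (c i)) :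
    uniformLaw Ω B ≤ ENNReal.ofReal ((∏ i, c i) / volume.real Ω) := by
  have hV : volume Ω = ENNReal.ofReal (volume.real Ω) :=
    (ENNReal.ofReal_toReal (measure_ne_top_of_subset_cube hcube)).symm
  have hV0 : 0 < volume.real Ω :=
    ENNReal.toReal_pos hpos.ne' (measure_ne_top_of_subset_cube hcube)
  rw [uniformLaw_apply hΩ, div_eq_inv_mul, ENNReal.ofReal_mul (by positivity),
    ENNReal.ofReal_inv_of_pos hV0, ← hV]
  gcongr
  calc volume ((↑) '' B : Set (Space d)) ≤ volume {x : Space d | ∀ i, x i ∈ A i} := by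
        refine measure_mono ?_
        rintro _ ⟨x, hx, rfl⟩
        exact hB x hx
    _ = ∏ i, volume (A i) := volume_box A hA
    _ ≤ ∏ i, ENNReal.ofReal (c i) := Finset.prod_le_prod' fun i _ => hc i
    _ = ENNReal.ofReal (∏ i, c i) :=
        (ENNReal.ofReal_prod_of_nonneg (fun i _ => hc0 i)).symm

lemma uniformLaw_coord_le {d : ℕ} {Ω : Set (Space d)} (hΩ : MeasurableSet Ω)
    (hcube : Ω ⊆ unitCube d) (hpos : 0 < volume Ω) (i : Fin d) (B : Set Ω) (A : Set ℝ)
    (hA : MeasurableSet A) (hB : ∀ x ∈ B, (x : Space d) i ∈ A) {c : ℝ} (hc0 : 0 ≤ c)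
    (hc : volume A ≤ ENNReal.ofReal c) :
    uniformLaw Ω B ≤ ENNReal.ofReal (c / volume.real Ω) := by
  classical
  -- The remaining coordinates are only confined to `[0, 1]` and contribute factors `1`.
  refine (uniformLaw_box_le hΩ hcube hpos B (Function.update (fun _ => Set.Icc 0 1) i A) ?_ ?_
    (Function.update (fun _ => 1) i c) ?_ ?_).trans (le_of_eq ?_)
  · intro j
    by_cases h : j = i
    · subst h; simpa
    · simp [h]
  · intro x hx j
    by_cases h : j = i
    · subst h; simpa using hB x hx
    · simpa [h] using hcube x.2 j
  · intro j
    by_cases h : j = i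
    · subst h; simpa
    · simp [h]
  · intro j
    by_cases h : j = i
    · subst h; simpa
    · simp [h]
  · congr 2
    rw [Finset.prod_eq_single i]
    · simp
    · intro j _ h
      simp [h]
    · simp

/-! ### Smooth plateau functions -/

/-- A smooth function that is `1` on `[γ, 1 - γ]` and vanishes off `(0, 1)`. -/
def plateau (γ t : ℝ) : ℝ := Real.smoothTransition (t / γ) * Real.smoothTransition ((1 - t) / γ)

lemma contDiff_plateau (γ : ℝ) {n : ℕ∞} : ContDiff ℝ n (plateau γ) := by
  unfold plateau
  exact (Real.smoothTransition.contDiff.comp (contDiff_id.div_const γ)).mul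
    (Real.smoothTransition.contDiff.comp ((contDiff_const.sub contDiff_id).div_const γ))

lemma continuous_plateau (γ : ℝ) : Continuous (plateau γ) := (contDiff_plateau γ (n := 0)).continuous

lemma plateau_nonneg (γ t : ℝ) : 0 ≤ plateau γ t :=
  mul_nonneg (Real.smoothTransition.nonneg _) (Real.smoothTransition.nonneg _)

lemma plateau_le_one (γ t : ℝ) : plateau γ t ≤ 1 :=
  mul_le_one₀ (Real.smoothTransition.le_one _) (Real.smoothTransition.nonneg _)
    (Real.smoothTransition.le_one _)

lemma plateau_of_nonpos {γ t : ℝ} (hγ : 0 < γ) (ht : t ≤ 0) : plateau γ t = 0 := by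
  rw [plateau, Real.smoothTransition.zero_of_nonpos (div_nonpos_of_nonpos_of_nonneg ht hγ.le),
    zero_mul]

lemma plateau_of_one_le {γ t : ℝ} (hγ : 0 < γ) (ht : 1 ≤ t) : plateau γ t = 0 := by
  rw [plateau, Real.smoothTransition.zero_of_nonpos (x := (1 - t) / γ)
    (div_nonpos_of_nonpos_of_nonneg (by linarith) hγ.le), mul_zero]

lemma plateau_eq_one {γ t : ℝ} (hγ : 0 < γ) (h0 : γ ≤ t) (h1 : t ≤ 1 - γ) : plateau γ t = 1 := by
  rw [plateau, Real.smoothTransition.one_of_one_le ((one_le_div hγ).2 h0),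
    Real.smoothTransition.one_of_one_le ((one_le_div hγ).2 (by linarith)), mul_one]

lemma plateau_sub_eq_zero {γ t : ℝ} (hγ : 0 < γ) (ht : 0 ≤ t) {l : ℕ} (hl : l ≠ ⌊t⌋₊) :
    plateau γ (t - l) = 0 := by
  rcases lt_or_gt_of_ne hl with h | h
  · refine plateau_of_one_le hγ ?_
    have h1 : ((l + 1 : ℕ) : ℝ) ≤ t := (Nat.le_floor_iff ht).1 h
    push_cast at h1
    linarith
  · exact plateau_of_nonpos hγ (by linarith [(Nat.floor_lt ht).1 h])

/-- For `N > 0` the value `N` is attained at `t = 1`; this is why cells are indexed by `Fin (N + 1)`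
throughout. -/
lemma floor_lt_succ {N : ℕ} {t : ℝ} (ht : t ∈ Set.Icc (0 : ℝ) 1) : ⌊N * t⌋₊ < N + 1 := by
  rw [Nat.floor_lt (mul_nonneg N.cast_nonneg ht.1)]
  push_cast
  nlinarith [ht.2, (Nat.cast_nonneg N : (0 : ℝ) ≤ N)]

/-- The index of the cell of mesh `1 / N` that contains `t ∈ [0, 1]`. -/
def cellIndex (N : ℕ) (t : ℝ) : Fin (N + 1) := Fin.ofNat (N + 1) ⌊N * t⌋₊

lemma measurable_cellIndex (N : ℕ) : Measurable (cellIndex N) :=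
  (measurable_from_top (f := Fin.ofNat (N + 1))).comp (Nat.measurable_floor.comp (by fun_prop))

lemma val_cellIndex {N : ℕ} {t : ℝ} (ht : t ∈ Set.Icc (0 : ℝ) 1) :
    (cellIndex N t : ℕ) = ⌊N * t⌋₊ := by
  simpa [cellIndex, Fin.ofNat] using floor_lt_succ ht

lemma plateau_sub_eq_zero_of_ne {γ : ℝ} (hγ : 0 < γ) {N : ℕ} {t : ℝ} (ht : t ∈ Set.Icc (0 : ℝ) 1)
    {l : Fin (N + 1)} (hl : l ≠ cellIndex N t) : plateau γ (N * t - (l : ℕ)) = 0 := by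
  refine plateau_sub_eq_zero hγ (mul_nonneg N.cast_nonneg ht.1) fun h => hl (Fin.ext ?_)
  rw [h, val_cellIndex ht]

lemma volume_cell_le {N : ℕ} (l : Fin (N + 1)) :
    volume (Set.Icc ((l : ℕ) / N : ℝ) (((l : ℕ) + 1) / N)) ≤ ENNReal.ofReal (1 / N) := by
  rw [Real.volume_Icc]
  exact ENNReal.ofReal_le_ofReal (le_of_eq (by ring))

lemma mem_cell {N : ℕ} (hN : 0 < N) {t : ℝ} (ht : t ∈ Set.Icc (0 : ℝ) 1) {l : Fin (N + 1)}
    (h : cellIndex N t = l) : t ∈ Set.Icc ((l : ℕ) / N : ℝ) (((l : ℕ) + 1) / N) := by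
  have hN' : (0 : ℝ) < N := Nat.cast_pos.2 hN
  subst h
  rw [val_cellIndex ht]
  have h1 := Nat.floor_le (mul_nonneg hN'.le ht.1)
  have h2 := Nat.lt_floor_add_one (N * t)
  exact ⟨(div_le_iff₀ hN').2 (by linarith), (le_div_iff₀ hN').2 (by linarith)⟩

/-- The points near the boundaries of the cells of mesh `1 / N`. -/
def margin (γ : ℝ) (N : ℕ) : Set ℝ :=
  ⋃ l ∈ Finset.range (N + 1), Set.Icc (((l : ℕ) - γ) / N : ℝ) (((l : ℕ) + γ) / N)

lemma measurableSet_margin (γ : ℝ) (N : ℕ) : MeasurableSet (margin γ N) :=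
  Finset.measurableSet_biUnion _ fun _ _ => measurableSet_Icc

lemma volume_margin_le {γ : ℝ} (hγ : 0 < γ) {N : ℕ} (hN : 0 < N) :
    volume (margin γ N) ≤ ENNReal.ofReal (4 * γ) := by
  have hN' : (1 : ℝ) ≤ N := Nat.one_le_cast.2 hN
  refine (measure_biUnion_finset_le _ _).trans ?_
  simp_rw [Real.volume_Icc]
  rw [← ENNReal.ofReal_sum_of_nonneg]
  · refine ENNReal.ofReal_le_ofReal ?_
    have : ∀ l : ℕ, ((l : ℝ) + γ) / N - (l - γ) / N = 2 * γ / N := fun l => by ring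
    simp_rw [this]
    rw [Finset.sum_const, Finset.card_range, nsmul_eq_mul]
    push_cast
    rw [mul_div_assoc', div_le_iff₀ (by linarith)]
    nlinarith
  · intro l _
    rw [show ((l : ℝ) + γ) / N - (l - γ) / N = 2 * γ / N by ring]
    positivity

lemma plateau_cellIndex_eq_one {γ : ℝ} (hγ : 0 < γ) (hγ1 : γ < 1) {N : ℕ} (hN : 0 < N) {t : ℝ}
    (ht : t ∈ Set.Icc (0 : ℝ) 1) (hm : t ∉ margin γ N) :
    plateau γ (N * t - (cellIndex N t : ℕ)) = 1 := by
  have hN' : (0 : ℝ) < N := Nat.cast_pos.2 hN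
  rw [val_cellIndex ht]
  have h1 := Nat.floor_le (mul_nonneg hN'.le ht.1)
  have h2 := Nat.lt_floor_add_one (N * t)
  simp only [margin, Set.mem_iUnion, not_exists, Finset.mem_range, Set.mem_Icc, not_and] at hm
  refine plateau_eq_one hγ ?_ ?_
  · by_contra! h
    refine hm ⌊N * t⌋₊ (floor_lt_succ ht) ((div_le_iff₀ hN').2 (by linarith))
      ((le_div_iff₀ hN').2 (by linarith))
  · by_contra! h
    -- In the degenerate last cell `N t - N ≤ 0 < 1 - γ`. Hence the right end point of the cell is a
    -- grid point of index at most `N`, whose neighbourhood belongs to `margin`.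
    have h3 : ⌊N * t⌋₊ ≠ N := by
      intro h4
      rw [h4] at h
      nlinarith [ht.2]
    have h4 := floor_lt_succ (N := N) ht
    refine hm (⌊N * t⌋₊ + 1) (by omega) ((div_le_iff₀ hN').2 (by push_cast; linarith))
      ((le_div_iff₀ hN').2 (by push_cast; linarith))

/-! ### Derivatives of the plateau functions -/

lemma hasDerivAt_iteratedDeriv_plateau (γ : ℝ) (j : ℕ) (t : ℝ) :
    HasDerivAt (iteratedDeriv j (plateau γ)) (iteratedDeriv (j + 1) (plateau γ) t) t := by
  rw [iteratedDeriv_succ]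
  exact (((contDiff_plateau γ (n := ⊤)).differentiable_iteratedDeriv j
    (by exact_mod_cast ENat.natCast_lt_top j)) t).hasDerivAt

lemma iteratedDeriv_plateau_eq_zero {γ : ℝ} (hγ : 0 < γ) (j : ℕ) {t : ℝ}
    (ht : t < 0 ∨ 1 < t) : iteratedDeriv j (plateau γ) t = 0 := by
  have h : plateau γ =ᶠ[nhds t] fun _ => 0 := by
    rcases ht with h | h
    · filter_upwards [gt_mem_nhds h] with u hu using plateau_of_nonpos hγ hu.le
    · filter_upwards [lt_mem_nhds h] with u hu using plateau_of_one_le hγ hu.le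
  rw [h.iteratedDeriv_eq j]
  simp

lemma exists_iteratedDeriv_plateau_le {γ : ℝ} (hγ : 0 < γ) (r : ℕ) :
    ∃ M : ℝ, 0 < M ∧ ∀ j ≤ r, ∀ t, |iteratedDeriv j (plateau γ) t| ≤ M := by
  have h : ∀ j : ℕ, ∃ M : ℝ, ∀ t, |iteratedDeriv j (plateau γ) t| ≤ M := by
    intro j
    have hc : Continuous (iteratedDeriv j (plateau γ)) := continuous_iff_continuousAt.2 fun t =>
      (hasDerivAt_iteratedDeriv_plateau γ j t).continuousAt
    have hs : HasCompactSupport (iteratedDeriv j (plateau γ)) :=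
      HasCompactSupport.of_support_subset_isCompact (isCompact_Icc (a := 0) (b := 1)) fun t ht => by
        by_contra hn
        refine ht (iteratedDeriv_plateau_eq_zero hγ j ?_)
        by_contra! h
        exact hn h
    simpa using hs.exists_bound_of_continuous hc
  choose M hM using h
  refine ⟨1 + ∑ j ∈ Finset.range (r + 1), |M j|, by positivity, fun j hj t => ?_⟩
  have h1 := Finset.single_le_sum (f := fun j => |M j|) (fun i _ => abs_nonneg _)
    (Finset.mem_range.2 (Nat.lt_succ_of_le hj))
  have h2 := hM j t
  have h3 := le_abs_self (M j)
  linarith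

/-- The derivatives vanish off `[0, 1]`, and a point lies in at most two of the closed intervals
`[l, l + 1]`. The bound therefore does not grow with the number of bumps. -/
lemma sum_abs_iteratedDeriv_plateau_le {γ : ℝ} (hγ : 0 < γ) {j : ℕ} {M : ℝ} (hM0 : 0 < M)
    (hM : ∀ t, |iteratedDeriv j (plateau γ) t| ≤ M) (N : ℕ) (t : ℝ) :
    ∑ l : Fin N, |iteratedDeriv j (plateau γ) (t - (l : ℕ))| ≤ 2 * M := by
  classical
  have hcard : (Finset.univ.filter fun l : Fin N => t - 1 ≤ (l : ℕ) ∧ ((l : ℕ) : ℝ) ≤ t).card ≤ 2 := by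
    refine le_trans (Finset.card_le_card_of_injOn (t := ({⌊t⌋₊, ⌊t⌋₊ - 1} : Finset ℕ))
      (fun l : Fin N => (l : ℕ)) ?_ (fun a _ b _ h => Fin.ext h)) Finset.card_le_two
    intro l hl
    simp only [Finset.coe_filter, Finset.mem_univ, true_and, Set.mem_ofPred_eq] at hl
    have h1 : (l : ℕ) ≤ ⌊t⌋₊ := Nat.le_floor hl.2
    have h2 : ⌊t⌋₊ < l + 2 := by
      rw [Nat.floor_lt ((Nat.cast_nonneg _).trans hl.2)]
      push_cast
      linarith [hl.1]
    simp only [Finset.coe_insert, Finset.coe_singleton, Set.mem_insert_iff, Set.mem_singleton_iff]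
    omega
  rw [← Finset.sum_filter_of_ne (p := fun l : Fin N => t - 1 ≤ (l : ℕ) ∧ ((l : ℕ) : ℝ) ≤ t)]
  · refine (Finset.sum_le_card_nsmul _ _ M fun l _ => hM _).trans ?_
    rw [nsmul_eq_mul]
    gcongr
    exact_mod_cast hcard
  · intro l _ hl
    by_contra h
    refine hl (abs_eq_zero.2 (iteratedDeriv_plateau_eq_zero hγ j ?_))
    rw [not_and_or, not_le, not_le] at h
    rcases h with h | h
    · right; linarith
    · left; linarith

/-! ### Sums of bumps -/

/-- The partial derivative of order `α` of the function
`x ↦ A K^(-s) ∑ₖ cₖ ∏ᵢ plateau γ (K xᵢ - kᵢ)`. -/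
def bumpSum {d : ℕ} (γ A s : ℝ) (K : ℕ) (c : (Fin d → Fin (K + 1)) → ℝ) (α : Fin d → ℕ)
    (x : Space d) : ℝ :=
  A * (K : ℝ) ^ (((∑ i, α i : ℕ) : ℝ) - s) *
    ∑ k, c k * ∏ i, iteratedDeriv (α i) (plateau γ) (K * x i - (k i : ℕ))

/-- Each differentiation produces one factor `K`, which the exponent `|α| - s` absorbs. The
functions `bumpSum` thus form a family of partial derivatives on the whole space, whatever `Ω` is.
-/
lemma hasFDerivAt_bumpSum {d : ℕ} (γ A s : ℝ) {K : ℕ} (hK : 0 < K)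
    (c : (Fin d → Fin (K + 1)) → ℝ) (α : Fin d → ℕ) (x : Space d) :
    HasFDerivAt (bumpSum γ A s K c α) (∑ i, bumpSum γ A s K c (α + Pi.single i 1) x •
      (EuclideanSpace.proj i : Space d →L[ℝ] ℝ)) x := by
  classical
  have h1 : ∀ (k : Fin d → Fin (K + 1)) (i : Fin d), HasFDerivAt
      (fun x : Space d => iteratedDeriv (α i) (plateau γ) (K * x i - (k i : ℕ)))
      ((iteratedDeriv (α i + 1) (plateau γ) (K * x i - (k i : ℕ)) * K) •
        (EuclideanSpace.proj i : Space d →L[ℝ] ℝ)) x := by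
    intro k i
    have hp : HasFDerivAt (fun x : Space d => (K : ℝ) * x i - (k i : ℕ))
        ((K : ℝ) • (EuclideanSpace.proj i : Space d →L[ℝ] ℝ)) x :=
      (((EuclideanSpace.proj i : Space d →L[ℝ] ℝ).hasFDerivAt).const_mul (K : ℝ)).sub_const _
    have := (hasDerivAt_iteratedDeriv_plateau γ (α i) (K * x i - (k i : ℕ))).comp_hasFDerivAt x hp
    rwa [smul_smul] at this
  have h2 := (HasFDerivAt.fun_sum (u := Finset.univ) fun k (_ : k ∈ Finset.univ) =>
    (HasFDerivAt.finsetProd (u := Finset.univ) fun i (_ : i ∈ Finset.univ) => h1 k i).const_mul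
      (c k)).const_mul (A * (K : ℝ) ^ (((∑ i, α i : ℕ) : ℝ) - s))
  refine h2.congr_fderiv ?_
  simp_rw [Finset.smul_sum]
  rw [Finset.sum_comm]
  refine Finset.sum_congr rfl fun i _ => ?_
  simp_rw [smul_smul, ← Finset.sum_smul]
  congr 1
  have hα : ∑ j, (α + Pi.single i 1 : Fin d → ℕ) j = ∑ j, α j + 1 := by
    simp [Finset.sum_add_distrib]
  rw [bumpSum, hα, Finset.mul_sum]
  refine Finset.sum_congr rfl fun k _ => ?_
  have hpow : (K : ℝ) ^ (((∑ j, α j + 1 : ℕ) : ℝ) - s) = (K : ℝ) ^ (((∑ i, α i : ℕ) : ℝ) - s) * K := by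
    rw [← Real.rpow_add_one (Nat.cast_pos.2 hK).ne']
    congr 1
    push_cast
    ring
  rw [hpow, ← Finset.mul_prod_erase Finset.univ _ (Finset.mem_univ i)]
  have herase : ∏ j ∈ Finset.univ.erase i, iteratedDeriv ((α + Pi.single i 1 : Fin d → ℕ) j) (plateau γ)
      (K * x j - (k j : ℕ)) =
      ∏ j ∈ Finset.univ.erase i, iteratedDeriv (α j) (plateau γ) (K * x j - (k j : ℕ)) :=
    Finset.prod_congr rfl fun j hj => by simp [(Finset.mem_erase.1 hj).1]
  rw [herase]
  simp only [Pi.add_apply, Pi.single_eq_same]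
  ring

/-- The sum over cells of products over coordinates factorises into a product of one-dimensional
sums, each at most `2M`. Apart from the scaling power, the bound is free of `K`. -/
lemma abs_bumpSum_le {d : ℕ} {γ A s M : ℝ} (hγ : 0 < γ) (hA : 0 ≤ A) (hM0 : 0 < M) {K : ℕ}
    {c : (Fin d → Fin (K + 1)) → ℝ} (hc : ∀ k, |c k| ≤ 1) {α : Fin d → ℕ}
    (hM : ∀ i t, |iteratedDeriv (α i) (plateau γ) t| ≤ M) (x : Space d) :
    |bumpSum γ A s K c α x| ≤ A * (K : ℝ) ^ (((∑ i, α i : ℕ) : ℝ) - s) * (2 * M) ^ d := by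
  have hK : 0 ≤ (K : ℝ) ^ (((∑ i, α i : ℕ) : ℝ) - s) := Real.rpow_nonneg (Nat.cast_nonneg _) _
  rw [bumpSum, abs_mul, abs_of_nonneg (mul_nonneg hA hK)]
  refine mul_le_mul_of_nonneg_left ?_ (mul_nonneg hA hK)
  calc |∑ k, c k * ∏ i, iteratedDeriv (α i) (plateau γ) (K * x i - (k i : ℕ))|
      ≤ ∑ k : Fin d → Fin (K + 1), ∏ i, |iteratedDeriv (α i) (plateau γ) (K * x i - (k i : ℕ))| := by
        refine (Finset.abs_sum_le_sum_abs _ _).trans (Finset.sum_le_sum fun k _ => ?_)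
        rw [abs_mul, Finset.abs_prod]
        exact mul_le_of_le_one_left (Finset.prod_nonneg fun _ _ => abs_nonneg _) (hc k)
    _ = ∏ i, ∑ l : Fin (K + 1), |iteratedDeriv (α i) (plateau γ) (K * x i - (l : ℕ))| := by
        rw [Finset.prod_univ_sum, Fintype.piFinset_univ]
    _ ≤ ∏ _i : Fin d, 2 * M := Finset.prod_le_prod
        (fun i _ => Finset.sum_nonneg fun _ _ => abs_nonneg _)
        (fun i _ => sum_abs_iteratedDeriv_plateau_le hγ hM0 (hM i) _ _)
    _ = (2 * M) ^ d := by simp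

lemma continuous_bumpSum {d : ℕ} (γ A s : ℝ) {K : ℕ} (hK : 0 < K)
    (c : (Fin d → Fin (K + 1)) → ℝ) (α : Fin d → ℕ) : Continuous (bumpSum γ A s K c α) :=
  continuous_iff_continuousAt.2 fun x => (hasFDerivAt_bumpSum γ A s hK c α x).continuousAt

/-! ### Hölder norms -/

lemma strictFloor_lt {s : ℝ} (hs : 0 < s) : (strictFloor s : ℝ) < s := by
  have h : strictFloor s < ⌈s⌉₊ := by
    have := Nat.ceil_pos.2 hs
    unfold strictFloor
    omega
  exact Nat.lt_ceil.1 h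

lemma le_strictFloor_add_one (s : ℝ) : s ≤ strictFloor s + 1 := by
  have h : ⌈s⌉₊ ≤ strictFloor s + 1 := by
    unfold strictFloor
    omega
  exact_mod_cast (Nat.le_ceil s).trans (by exact_mod_cast h)

/-- The number of terms in the Hölder norm. -/
def holderTerms (d : ℕ) (s : ℝ) : ℕ :=
  ∑ l ∈ Finset.range (strictFloor s + 1),
    (Finset.piAntidiag (Finset.univ : Finset (Fin d)) l).card +
    (Finset.piAntidiag (Finset.univ : Finset (Fin d)) (strictFloor s)).card

lemma holderNorm_le {d : ℕ} {Ω : Set (Space d)} {s M : ℝ}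
    {g : (Fin d → ℕ) → Space d → ℝ}
    (h0 : ∀ α : Fin d → ℕ, ∑ i, α i ≤ strictFloor s → ∀ x ∈ Ω, |g α x| ≤ M)
    (h1 : ∀ α : Fin d → ℕ, ∑ i, α i = strictFloor s → ∀ x ∈ Ω, ∀ y ∈ Ω,
      |g α x - g α y| ≤ M * ‖x - y‖ ^ (s - strictFloor s)) :
    holderNorm Ω s g ≤ ENNReal.ofReal (holderTerms d s * M) := by
  rw [ENNReal.ofReal_mul (Nat.cast_nonneg _), ENNReal.ofReal_natCast, holderTerms, Nat.cast_add,
    add_mul, Nat.cast_sum, Finset.sum_mul]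
  refine add_le_add (Finset.sum_le_sum fun l hl => ?_) ?_
  · rw [← nsmul_eq_mul]
    refine Finset.sum_le_card_nsmul _ _ _ fun α hα => ?_
    rw [Finset.mem_piAntidiag] at hα
    refine iSup₂_le fun x hx => ENNReal.ofReal_le_ofReal (h0 α ?_ x hx)
    rw [hα.1]
    exact Nat.lt_succ_iff.1 (Finset.mem_range.1 hl)
  · rw [← nsmul_eq_mul]
    refine Finset.sum_le_card_nsmul _ _ _ fun α hα => ?_
    rw [Finset.mem_piAntidiag] at hα
    refine iSup₂_le fun x hx => iSup₂_le fun y hy => iSup_le fun hxy =>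
      ENNReal.ofReal_le_ofReal ?_
    have : 0 < ‖x - y‖ := norm_pos_iff.2 (sub_ne_zero.2 hxy)
    exact (div_le_iff₀ (Real.rpow_pos_of_pos this _)).2 (h1 α hα.1 x hx y hy)

lemma inHolderBall_const {d : ℕ} {Ω : Set (Space d)} {s L t : ℝ}
    (ht : holderTerms d s * |t| ≤ L) : InHolderBall Ω s L fun _ => t := by
  classical
  refine ⟨fun α _ => if α = 0 then t else 0, ⟨fun x => by simp, fun α _ x _ => ?_⟩,
    (holderNorm_le (M := |t|) ?_ ?_).trans (ENNReal.ofReal_le_ofReal ht)⟩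
  · have : ∀ i : Fin d, α + Pi.single i 1 ≠ 0 := fun i h => by simpa using congrFun h i
    simp only [this, if_false, zero_smul, Finset.sum_const_zero]
    exact hasFDerivWithinAt_const _ _ _
  · intro α _ x _
    split_ifs <;> simp
  · intro α _ x _ y _
    rw [sub_self, abs_zero]
    positivity

/-- Interpolation between a sup bound (for large `u`) and a Lipschitz bound (for small `u`) into a
Hölder bound. -/
lemma min_le_mul_rpow {a u β : ℝ} (ha : 0 ≤ a) (hu : 0 ≤ u) (hβ0 : 0 < β) (hβ1 : β ≤ 1) :
    min 2 (a * u) ≤ (2 + a) * u ^ β := by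
  rcases le_total u 1 with h | h
  · refine (min_le_right _ _).trans ?_
    have h1 : u ≤ u ^ β := Real.self_le_rpow_of_le_one hu h hβ1
    nlinarith
  · refine (min_le_left _ _).trans ?_
    have := Real.one_le_rpow h hβ0.le
    nlinarith

/-- Derivatives of order `⌊s⌋` are `O(K^(⌊s⌋-s))`, those one order higher `O(K^(⌊s⌋+1-s))`.
Interpolating with exponent `s - ⌊s⌋ ∈ (0, 1]` cancels all powers of `K`, so one amplitude `A`
serves every mesh. -/
lemma inHolderBall_bumpSum {d : ℕ} {Ω : Set (Space d)} {γ s L A M : ℝ} (hγ : 0 < γ) (hs : 0 < s)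
    (hA : 0 ≤ A) (hM0 : 0 < M)
    (hM : ∀ j ≤ strictFloor s + 1, ∀ t, |iteratedDeriv j (plateau γ) t| ≤ M)
    (hL : holderTerms d s * ((2 + d) * (A * (2 * M) ^ d)) ≤ L) {K : ℕ} (hK : 0 < K)
    {c : (Fin d → Fin (K + 1)) → ℝ} (hc : ∀ k, |c k| ≤ 1) :
    InHolderBall Ω s L fun x => bumpSum γ A s K c 0 x := by
  have hK1 : (1 : ℝ) ≤ K := Nat.one_le_cast.2 hK
  have hK0 : (0 : ℝ) < K := by linarith
  have hB0 : 0 ≤ A * (2 * M) ^ d := by positivity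
  have hle : ∀ (α : Fin d → ℕ) i, α i ≤ ∑ i, α i := fun α i =>
    Finset.single_le_sum (fun _ _ => Nat.zero_le _) (Finset.mem_univ i)
  have hb : ∀ α : Fin d → ℕ, ∑ i, α i ≤ strictFloor s + 1 → ∀ x,
      |bumpSum γ A s K c α x| ≤ A * (2 * M) ^ d * (K : ℝ) ^ (((∑ i, α i : ℕ) : ℝ) - s) := by
    intro α hα x
    have := abs_bumpSum_le (s := s) hγ hA hM0 hc (fun i t => hM (α i) ((hle α i).trans hα) t) x
    linarith
  have hr := strictFloor_lt hs
  refine ⟨bumpSum γ A s K c, ⟨fun x => rfl, fun α _ x _ =>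
    (hasFDerivAt_bumpSum γ A s hK c α x).hasFDerivWithinAt⟩,
    (holderNorm_le (M := (2 + d) * (A * (2 * M) ^ d)) ?_ ?_).trans (ENNReal.ofReal_le_ofReal hL)⟩
  · intro α hα x _
    refine (hb α (hα.trans (Nat.le_succ _)) x).trans ?_
    have h1 : (K : ℝ) ^ (((∑ i, α i : ℕ) : ℝ) - s) ≤ 1 := by
      refine Real.rpow_le_one_of_one_le_of_nonpos hK1 ?_
      have : ((∑ i, α i : ℕ) : ℝ) ≤ strictFloor s := by exact_mod_cast hα
      linarith
    have h2 : A * (2 * M) ^ d * (K : ℝ) ^ (((∑ i, α i : ℕ) : ℝ) - s) ≤ A * (2 * M) ^ d :=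
      mul_le_of_le_one_right hB0 h1
    have h3 : (0 : ℝ) ≤ d := Nat.cast_nonneg d
    nlinarith
  · intro α hα x _ y _
    set E := A * (2 * M) ^ d * (K : ℝ) ^ ((strictFloor s : ℝ) - s) with hE
    have hE0 : 0 ≤ E := by positivity
    have h1 : ∀ z, |bumpSum γ A s K c α z| ≤ E := fun z => by
      have := hb α (by omega) z
      rwa [hα] at this
    have h2 : |bumpSum γ A s K c α x - bumpSum γ A s K c α y| ≤ E * (d * (K * ‖x - y‖)) := by
      have hder : ∀ z ∈ (Set.univ : Set (Space d)), ‖∑ i, bumpSum γ A s K c (α + Pi.single i 1) z •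
          (EuclideanSpace.proj i : Space d →L[ℝ] ℝ)‖ ≤ d * (E * K) := by
        intro z _
        refine (norm_sum_le_of_le _ (n := fun _ => E * K) fun i _ => ?_).trans (by simp)
        rw [norm_smul, Real.norm_eq_abs]
        have hp : ‖(EuclideanSpace.proj i : Space d →L[ℝ] ℝ)‖ ≤ 1 :=
          ContinuousLinearMap.opNorm_le_bound _ zero_le_one fun v => by
            simpa using PiLp.norm_apply_le v i
        have hα' : ∑ j, (α + Pi.single i 1 : Fin d → ℕ) j = strictFloor s + 1 := by
          simp [Finset.sum_add_distrib, hα]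
        have hb' := hb (α + Pi.single i 1) hα'.le z
        have hpow : (K : ℝ) ^ (((strictFloor s + 1 : ℕ) : ℝ) - s) =
            (K : ℝ) ^ ((strictFloor s : ℝ) - s) * K := by
          rw [← Real.rpow_add_one hK0.ne']
          congr 1
          push_cast
          ring
        rw [hα', hpow, ← mul_assoc] at hb'
        exact (mul_le_of_le_one_right (abs_nonneg _) hp).trans hb'
      -- The mean value inequality is used on all of `ℝ^d`, since `Ω` need not be convex.
      have := Convex.norm_image_sub_le_of_norm_hasFDerivWithin_le (s := Set.univ)
        (fun z _ => (hasFDerivAt_bumpSum γ A s hK c α z).hasFDerivWithinAt) hder convex_univ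
        (Set.mem_univ y) (Set.mem_univ x)
      rw [Real.norm_eq_abs] at this
      linarith
    have h3 : |bumpSum γ A s K c α x - bumpSum γ A s K c α y| ≤ E * 2 := by
      have := abs_sub (bumpSum γ A s K c α x) (bumpSum γ A s K c α y)
      linarith [h1 x, h1 y]
    have h4 : |bumpSum γ A s K c α x - bumpSum γ A s K c α y| ≤
        E * min 2 (d * (K * ‖x - y‖)) := by
      rw [mul_min_of_nonneg _ _ hE0]
      exact le_min h3 h2
    have h5 := min_le_mul_rpow (a := d) (u := K * ‖x - y‖) (β := s - strictFloor s)
      (Nat.cast_nonneg d) (by positivity) (by linarith) (by linarith [le_strictFloor_add_one s])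
    refine (h4.trans (mul_le_mul_of_nonneg_left h5 hE0)).trans (le_of_eq ?_)
    rw [Real.mul_rpow hK0.le (norm_nonneg _), hE]
    have h6 : (K : ℝ) ^ ((strictFloor s : ℝ) - s) * (K : ℝ) ^ (s - strictFloor s) = 1 := by
      rw [← Real.rpow_add hK0]
      simp
    linear_combination (2 + (d : ℝ)) * (A * (2 * M) ^ d) * ‖x - y‖ ^ (s - strictFloor s) * h6

lemma bumpSum_zero_eq {d : ℕ} {γ A s : ℝ} (hγ : 0 < γ) {K : ℕ} (c : (Fin d → Fin (K + 1)) → ℝ)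
    {x : Space d} (hx : x ∈ unitCube d) :
    bumpSum γ A s K c 0 x = c (fun i => cellIndex K (x i)) *
      (A * (K : ℝ) ^ (-s) * ∏ i, plateau γ (K * x i - (cellIndex K (x i) : ℕ))) := by
  rw [bumpSum, Finset.sum_eq_single fun i => cellIndex K (x i)]
  · simp
    ring
  · intro k _ hk
    obtain ⟨i, hi⟩ := Function.ne_iff.1 hk
    rw [Finset.prod_eq_zero (Finset.mem_univ i), mul_zero]
    simpa using plateau_sub_eq_zero_of_ne hγ (hx i) hi
  · simp

/-! ### Product measures -/

lemma pi_dirac {ι : Type*} [Fintype ι] {S : Type*} [MeasurableSpace S] (x : ι → S) :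
    Measure.pi (fun i => Measure.dirac (x i)) = Measure.dirac x := by
  classical
  refine Measure.pi_eq fun s hs => ?_
  rw [Measure.dirac_apply' _ (MeasurableSet.univ_pi hs)]
  simp_rw [Measure.dirac_apply' _ (hs _)]
  by_cases h : x ∈ Set.univ.pi s
  · rw [Set.indicator_of_mem h]
    exact (Finset.prod_eq_one fun i _ => Set.indicator_of_mem (h i trivial) _).symm
  · rw [Set.indicator_of_notMem h]
    simp only [Set.mem_pi, Set.mem_univ, true_imp_iff, not_forall] at h
    obtain ⟨i, hi⟩ := h
    exact (Finset.prod_eq_zero (Finset.mem_univ i) (Set.indicator_of_notMem hi _)).symm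

/-- Distinct coordinates of a doubly indexed i.i.d. family are i.i.d. -/
lemma measurePreserving_select {ι Λ J : Type*} [Fintype ι] [Fintype Λ] [Fintype J]
    (ν : Measure ℝ) [IsProbabilityMeasure ν] {ρ : J → ι × Λ} (hρ : Function.Injective ρ) :
    MeasurePreserving (fun (η : ι → Λ → ℝ) p => η (ρ p).1 (ρ p).2)
      (Measure.pi fun _ : ι => Measure.pi fun _ : Λ => ν) (Measure.pi fun _ : J => ν) := by
  have hm : Measurable (fun (η : ι → Λ → ℝ) p => η (ρ p).1 (ρ p).2) := by fun_prop
  refine ⟨hm, (Measure.pi_eq fun s hs => ?_).symm⟩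
  rw [Measure.map_apply hm (MeasurableSet.univ_pi hs)]
  -- Coordinates outside the range of `ρ` are unconstrained and contribute factors `1`; injectivity
  -- leaves at most one constraint per coordinate.
  set t : ι × Λ → Set ℝ := Function.extend ρ s fun _ => Set.univ with ht
  have hset : (fun (η : ι → Λ → ℝ) p => η (ρ p).1 (ρ p).2) ⁻¹' Set.univ.pi s =
      Set.univ.pi fun i => Set.univ.pi fun l => t (i, l) := by
    ext η
    simp only [Set.mem_preimage, Set.mem_pi, Set.mem_univ, true_imp_iff]
    constructor
    · intro h i l
      by_cases hp : ∃ p, ρ p = (i, l)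
      · obtain ⟨p, hp⟩ := hp
        have := h p
        rw [hp] at this
        rwa [← hp, ht, hρ.extend_apply]
      · rw [ht, Function.extend_apply' _ _ _ hp]
        trivial
    · intro h p
      have := h (ρ p).1 (ρ p).2
      rwa [ht, hρ.extend_apply] at this
  rw [hset, Measure.pi_pi]
  simp_rw [Measure.pi_pi]
  rw [← Fintype.prod_prod_type' (f := fun i l => ν (t (i, l)))]
  refine (Finset.prod_of_injOn ρ hρ.injOn (fun _ _ => Finset.mem_coe.2 (Finset.mem_univ _))
    (fun q _ hq => ?_) fun p _ => ?_).symm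
  · have : ¬ ∃ p, ρ p = q := fun ⟨p, hp⟩ => hq ⟨p, by simp, hp⟩
    simp [ht, Function.extend_apply' _ _ _ this]
  · simp [ht, hρ.extend_apply]

/-! ### Regression function plus interpolated independent noise -/

variable {d n m : ℕ} {Ω : Set (Space d)} {Λ : Type*} [Fintype Λ]

/-- The path `x ↦ f x + ∑ₗ wₗ(x) ηₗ`. -/
def noisyPath (f : C(Ω, ℝ)) (w : Λ → C(Ω, ℝ)) (η : Λ → ℝ) : PathSpace Ω :=
  ⟨fun x => f x + ∑ l, w l x * η l, by fun_prop⟩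

lemma measurable_noisyPath (f : C(Ω, ℝ)) (w : Λ → C(Ω, ℝ)) : Measurable (noisyPath f w) :=
  Measurable.subtype_mk (measurable_pi_lambda _ fun x => by fun_prop)

/-- A function continuous in the point and measurable in the path is jointly measurable. -/
lemma measurable_eval : Measurable fun p : PathSpace Ω × Ω => p.1.1 p.2 := by
  have := measurable_uncurry_of_continuous_of_measurable (u := fun (x : Ω) (z : PathSpace Ω) => z.1 x)
    (fun z => z.2) (fun x => (measurable_pi_apply x).comp measurable_subtype_coe)
  exact this.comp measurable_swap

lemma measurable_observe : Measurable (observe : SampleSpace n m Ω → DataSet n m Ω) := by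
  refine measurable_pi_lambda _ fun i => measurable_pi_lambda _ fun j => ?_
  have h1 : Measurable fun ω : SampleSpace n m Ω => ω.1 i j := by fun_prop
  refine h1.prodMk (Measurable.add (measurable_eval.comp (Measurable.prodMk ?_ h1)) ?_)
  · exact (measurable_pi_apply i).comp (measurable_fst.comp measurable_snd)
  · exact (measurable_pi_apply j).comp ((measurable_pi_apply i).comp
      (measurable_snd.comp measurable_snd))

variable {ψ : ℝ → ℝ} {a C : ℝ}

/-- The law of the random functions `noisyPath f w η` where `η` is i.i.d. with density `ψ²`;
there is no measurement noise. -/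
def noisyLaw (n m : ℕ) (hψ : IsRootDensity ψ a C) (f : C(Ω, ℝ)) (w : Λ → C(Ω, ℝ)) : Law n m Ω where
  pathLaw := ⟨(Measure.pi fun _ : Λ => hψ.law).map (noisyPath f w),
    Measure.isProbabilityMeasure_map (measurable_noisyPath f w).aemeasurable⟩
  noiseLaw _ _ := ⟨Measure.dirac 0, inferInstance⟩

lemma ae_abs_sum_le (hψ : IsRootDensity ψ a C) {w : Λ → C(Ω, ℝ)} (hw : ∀ x, ∑ l, |w l x| ≤ 1) :
    ∀ᵐ η ∂(Measure.pi fun _ : Λ => hψ.law), ∀ x, |∑ l, w l x * η l| ≤ a := by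
  have h : ∀ᵐ η ∂(Measure.pi fun _ : Λ => hψ.law), ∀ l, |η l| ≤ a :=
    ae_all_iff.2 fun l => (Measure.tendsto_eval_ae_ae (μ := fun _ : Λ => hψ.law) (i := l)).eventually
      hψ.ae_abs_le
  have ha : 0 ≤ a := by
    obtain ⟨u, hu⟩ := hψ.ae_abs_le.exists
    exact (abs_nonneg u).trans hu
  filter_upwards [h] with η hη x
  calc |∑ l, w l x * η l| ≤ ∑ l, |w l x| * a := by
        refine (Finset.abs_sum_le_sum_abs _ _).trans (Finset.sum_le_sum fun l _ => ?_)
        rw [abs_mul]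
        exact mul_le_mul_of_nonneg_left (hη l) (abs_nonneg _)
    _ ≤ a := by
        rw [← Finset.sum_mul]
        exact mul_le_of_le_one_left ha (hw x)

lemma integrable_eval_law (hψ : IsRootDensity ψ a C) (l : Λ) :
    Integrable (fun η : Λ → ℝ => η l) (Measure.pi fun _ : Λ => hψ.law) :=
  integrable_comp_eval (μ := fun _ : Λ => hψ.law) (i := l) (f := fun u : ℝ => u)
    hψ.integrable_id_law

lemma integrable_noisyPath (hψ : IsRootDensity ψ a C) (f : C(Ω, ℝ)) (w : Λ → C(Ω, ℝ)) (x : Ω) :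
    Integrable (fun η : Λ → ℝ => f x + ∑ l, w l x * η l) (Measure.pi fun _ : Λ => hψ.law) := by
  refine (integrable_const _).add (integrable_finsetSum _ fun l _ => Integrable.const_mul ?_ _)
  exact integrable_eval_law hψ l

lemma noisyLaw_mean (hψ : IsRootDensity ψ a C) (f : C(Ω, ℝ)) (w : Λ → C(Ω, ℝ)) :
    (noisyLaw n m hψ f w).mean = f := by
  funext x
  have he : Measurable fun z : PathSpace Ω => z.1 x :=
    (measurable_pi_apply x).comp measurable_subtype_coe
  have h1 : ∀ l, Integrable (fun η : Λ → ℝ => w l x * η l) (Measure.pi fun _ : Λ => hψ.law) :=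
    fun l => (integrable_eval_law hψ l).const_mul _
  change ∫ z, z.1 x ∂((Measure.pi fun _ : Λ => hψ.law).map (noisyPath f w)) = f x
  rw [integral_map (measurable_noisyPath f w).aemeasurable he.aestronglyMeasurable]
  change ∫ η : Λ → ℝ, f x + ∑ l, w l x * η l ∂(Measure.pi fun _ : Λ => hψ.law) = f x
  rw [integral_add (integrable_const _) (integrable_finsetSum _ fun l _ => h1 l),
    integral_finsetSum _ fun l _ => h1 l]
  simp_rw [integral_const_mul]
  have h2 : ∀ l : Λ, ∫ η : Λ → ℝ, η l ∂(Measure.pi fun _ : Λ => hψ.law) = 0 := fun l =>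
    (integral_comp_eval (μ := fun _ : Λ => hψ.law) (i := l) (f := fun u : ℝ => u)
      hψ.integrable_id_law.aestronglyMeasurable).trans hψ.integral_id_law
  simp [h2]

/-- The support radius `b₂ log 2` makes `|U| / b₂ ≤ log 2` almost surely, simultaneously at all
points. Zero measurement noise meets the last two conditions for any `b₃`. -/
lemma noisyLaw_admissible [IsProbabilityMeasure (uniformLaw Ω)] {s L b₂ b₃ : ℝ} (hb₂ : 0 < b₂)
    (hψ : IsRootDensity ψ (b₂ * Real.log 2) C) (f : C(Ω, ℝ)) (w : Λ → C(Ω, ℝ))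
    (hf : InHolderBall Ω s L f) (hw : ∀ x, ∑ l, |w l x| ≤ 1) :
    (noisyLaw n m hψ f w).Admissible s L b₂ b₃ where
  integrable x := by
    have he : Measurable fun z : PathSpace Ω => z.1 x :=
      (measurable_pi_apply x).comp measurable_subtype_coe
    exact (integrable_map_measure he.aestronglyMeasurable
      (measurable_noisyPath f w).aemeasurable).2 (integrable_noisyPath hψ f w x)
  holder := by rwa [noisyLaw_mean]
  process := by
    refine ⟨fun h => absurd h hb₂.ne', fun _ => ?_⟩
    rw [noisyLaw_mean]
    have hm : Measurable fun p : PathSpace Ω × Ω =>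
        ENNReal.ofReal (Real.exp (|p.1.1 p.2 - f p.2| / b₂)) := by
      have := measurable_eval (Ω := Ω)
      fun_prop
    rw [lintegral_prod_symm _ hm.aemeasurable]
    calc _ ≤ ∫⁻ _ : Ω, 2 ∂uniformLaw Ω := by
          refine lintegral_mono fun x => ?_
          change ∫⁻ z, _ ∂((Measure.pi fun _ : Λ => hψ.law).map (noisyPath f w)) ≤ 2
          rw [lintegral_map (by exact hm.comp measurable_prodMk_right) (measurable_noisyPath f w)]
          calc _ ≤ ∫⁻ _ : Λ → ℝ, 2 ∂(Measure.pi fun _ : Λ => hψ.law) := by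
                refine lintegral_mono_ae ?_
                filter_upwards [ae_abs_sum_le hψ hw] with η hη
                have : |f x + ∑ l, w l x * η l - f x| / b₂ ≤ Real.log 2 := by
                  rw [add_sub_cancel_left, div_le_iff₀ hb₂, mul_comm]
                  exact hη x
                refine (ENNReal.ofReal_le_ofReal (Real.exp_le_exp.2 this)).trans ?_
                rw [Real.exp_log two_pos]
                simp
            _ = 2 := by simp
      _ = 2 := by simp
  noise_mean i j := by
    change ∫ e, e ∂(Measure.dirac (0 : ℝ)) = 0
    simp
  noise i j := by
    change IsSubExp (Measure.dirac (0 : ℝ)) _ _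
    refine ⟨fun _ => by simp, fun _ => ?_⟩
    rw [lintegral_dirac]
    simp

/-! ### The prediction error -/

/-- The law of the design. -/
def designLaw (n m : ℕ) (Ω : Set (Space d)) : Measure (Fin n → Fin m → Ω) :=
  Measure.pi fun _ : Fin n => Measure.pi fun _ : Fin m => uniformLaw Ω

/-- The data for given design `X` and noise `η`. -/
def noisyData (f : C(Ω, ℝ)) (w : Λ → C(Ω, ℝ)) (X : Fin n → Fin m → Ω) (η : Fin n → Λ → ℝ) :
    DataSet n m Ω :=
  fun i j => (X i j, f (X i j) + ∑ l, w l (X i j) * η i l)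

/-- The mean squared error of the estimator `F` of `f x`, for given design `X`. -/
def designError (hψ : IsRootDensity ψ a C) (f : C(Ω, ℝ)) (w : Λ → C(Ω, ℝ)) (F : Estimator n m Ω)
    (x : Ω) (X : Fin n → Fin m → Ω) : ℝ≥0∞ :=
  ∫⁻ η, ENNReal.ofReal ((F.1 (noisyData f w X η) x - f x) ^ 2)
    ∂Measure.pi fun _ : Fin n => Measure.pi fun _ : Λ => hψ.law

/-- The mean squared error of the estimator `F` of `f x`. -/
def pointError (hψ : IsRootDensity ψ a C) (f : C(Ω, ℝ)) (w : Λ → C(Ω, ℝ)) (F : Estimator n m Ω)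
    (x : Ω) : ℝ≥0∞ :=
  ∫⁻ X, designError hψ f w F x X ∂designLaw n m Ω

lemma measurable_noisyData (f : C(Ω, ℝ)) (w : Λ → C(Ω, ℝ)) :
    Measurable fun p : (Fin n → Fin m → Ω) × (Fin n → Λ → ℝ) => noisyData f w p.1 p.2 := by
  have hf := f.continuous.measurable
  have hw := fun l => (w l).continuous.measurable
  unfold noisyData
  fun_prop

lemma measurable_error_integrand (f : C(Ω, ℝ)) (w : Λ → C(Ω, ℝ)) (F : Estimator n m Ω) :
    Measurable fun p : (Ω × (Fin n → Fin m → Ω)) × (Fin n → Λ → ℝ) =>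
      ENNReal.ofReal ((F.1 (noisyData f w p.1.2 p.2) p.1.1 - f p.1.1) ^ 2) := by
  have hf := f.continuous.measurable
  have h := (measurable_noisyData (n := n) (m := m) f w).comp
    (g := fun p : (Fin n → Fin m → Ω) × (Fin n → Λ → ℝ) => noisyData f w p.1 p.2)
    (f := fun p : (Ω × (Fin n → Fin m → Ω)) × (Fin n → Λ → ℝ) => (p.1.2, p.2)) (by fun_prop)
  have h2 := F.2.comp (h.prodMk (measurable_fst.comp measurable_fst))
  exact ((h2.sub (hf.comp (measurable_fst.comp measurable_fst))).pow_const 2).ennreal_ofReal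

lemma measurable_designError (hψ : IsRootDensity ψ a C) (f : C(Ω, ℝ)) (w : Λ → C(Ω, ℝ))
    (F : Estimator n m Ω) :
    Measurable fun p : Ω × (Fin n → Fin m → Ω) => designError hψ f w F p.1 p.2 :=
  (measurable_error_integrand f w F).lintegral_prod_right'

lemma measurable_pointError [IsProbabilityMeasure (uniformLaw Ω)] (hψ : IsRootDensity ψ a C)
    (f : C(Ω, ℝ)) (w : Λ → C(Ω, ℝ)) (F : Estimator n m Ω) : Measurable (pointError hψ f w F) := by
  have : IsProbabilityMeasure (designLaw n m Ω) := by unfold designLaw; infer_instance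
  exact (measurable_designError hψ f w F).lintegral_prod_right'

lemma lintegral_sampleLaw [IsProbabilityMeasure (uniformLaw Ω)] (hψ : IsRootDensity ψ a C)
    (f : C(Ω, ℝ)) (w : Λ → C(Ω, ℝ)) {G : SampleSpace n m Ω → ℝ≥0∞} (hG : Measurable G) :
    ∫⁻ ω, G ω ∂(noisyLaw n m hψ f w).sampleLaw =
      ∫⁻ X, ∫⁻ η, G (X, fun i => noisyPath f w (η i), 0)
        ∂(Measure.pi fun _ : Fin n => Measure.pi fun _ : Λ => hψ.law) ∂designLaw n m Ω := by
  have e1 : (Measure.pi fun i : Fin n => Measure.pi fun j : Fin m =>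
      ((noisyLaw n m hψ f w).noiseLaw i j : Measure ℝ)) = Measure.dirac 0 := by
    change (Measure.pi fun i : Fin n => Measure.pi fun j : Fin m => Measure.dirac (0 : ℝ)) = _
    rw [pi_dirac (fun _ : Fin m => (0 : ℝ)), pi_dirac]
    rfl
  have e2 : (Measure.pi fun _ : Fin n => ((noisyLaw n m hψ f w).pathLaw : Measure (PathSpace Ω))) =
      (Measure.pi fun _ : Fin n => Measure.pi fun _ : Λ => hψ.law).map
        fun η i => noisyPath f w (η i) := by
    have hp : IsProbabilityMeasure ((Measure.pi fun _ : Λ => hψ.law).map (noisyPath f w)) :=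
      Measure.isProbabilityMeasure_map (measurable_noisyPath f w).aemeasurable
    exact (Measure.pi_map_pi (μ := fun _ : Fin n => Measure.pi fun _ : Λ => hψ.law)
      (f := fun _ => noisyPath f w) (fun _ => (measurable_noisyPath f w).aemeasurable)).symm
  rw [Law.sampleLaw, e1, e2, lintegral_prod _ hG.aemeasurable]
  refine lintegral_congr fun X => ?_
  have hGX : Measurable fun q : (Fin n → PathSpace Ω) × (Fin n → Fin m → ℝ) => G (X, q) :=
    hG.comp measurable_prodMk_left
  have hp : IsProbabilityMeasure ((Measure.pi fun _ : Fin n => Measure.pi fun _ : Λ => hψ.law).map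
      fun η i => noisyPath f w (η i)) := Measure.isProbabilityMeasure_map
    (measurable_pi_lambda _ fun i =>
      (measurable_noisyPath f w).comp (measurable_pi_apply i)).aemeasurable
  rw [lintegral_prod _ hGX.aemeasurable]
  have h0 : ∀ z : Fin n → PathSpace Ω, ∫⁻ e, G (X, z, e) ∂(Measure.dirac (0 : Fin n → Fin m → ℝ)) =
      G (X, z, 0) := fun z => lintegral_dirac' _ (hGX.comp measurable_prodMk_left)
  simp_rw [h0]
  rw [lintegral_map (by exact hGX.comp measurable_prodMk_right)]
  exact measurable_pi_lambda _ fun i => (measurable_noisyPath f w).comp (measurable_pi_apply i)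

/-- By Tonelli the integral over `x` moves outside, so that lower bounds can be proved separately at
each point `x`. -/
lemma predictionError_noisyLaw [IsProbabilityMeasure (uniformLaw Ω)] (hψ : IsRootDensity ψ a C)
    (f : C(Ω, ℝ)) (w : Λ → C(Ω, ℝ)) (F : Estimator n m Ω) :
    (noisyLaw n m hψ f w).predictionError F = ∫⁻ x, pointError hψ f w F x ∂uniformLaw Ω := by
  have : IsProbabilityMeasure (designLaw n m Ω) := by unfold designLaw; infer_instance
  have hf := f.continuous.measurable
  rw [Law.predictionError, noisyLaw_mean]
  have hm : Measurable fun p : SampleSpace n m Ω × Ω =>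
      ENNReal.ofReal ((F.1 (observe p.1) p.2 - f p.2) ^ 2) :=
    (((F.2.comp ((measurable_observe.comp measurable_fst).prodMk measurable_snd)).sub
      (hf.comp measurable_snd)).pow_const 2).ennreal_ofReal
  rw [lintegral_sampleLaw hψ f w hm.lintegral_prod_right']
  have hobs : ∀ (X : Fin n → Fin m → Ω) (η : Fin n → Λ → ℝ),
      observe (X, (fun i => noisyPath f w (η i)), (0 : Fin n → Fin m → ℝ)) = noisyData f w X η := by
    intro X η
    funext i j
    simp [observe, noisyData, noisyPath]
  simp_rw [hobs]
  have hmeas := measurable_error_integrand (n := n) (m := m) f w F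
  have hsw : ∀ X : Fin n → Fin m → Ω,
      ∫⁻ η, ∫⁻ x, ENNReal.ofReal ((F.1 (noisyData f w X η) x - f x) ^ 2) ∂uniformLaw Ω
        ∂(Measure.pi fun _ : Fin n => Measure.pi fun _ : Λ => hψ.law) =
      ∫⁻ x, designError hψ f w F x X ∂uniformLaw Ω := by
    intro X
    refine lintegral_lintegral_swap ?_
    exact (hmeas.comp (g := _) (f := fun q : (Fin n → Λ → ℝ) × Ω => ((q.2, X), q.1))
      (by fun_prop)).aemeasurable
  simp_rw [hsw]
  exact lintegral_lintegral_swap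
    ((measurable_designError hψ f w F).comp measurable_swap).aemeasurable

/-- If the data depend on the regression function only through a shift of independent noise
variables, then two close regression functions cannot be distinguished. -/
lemma designError_pair (hψ : IsRootDensity ψ a C) {f f' : C(Ω, ℝ)} {w : Λ → C(Ω, ℝ)}
    (F : Estimator n m Ω) {x : Ω} (X : Fin n → Fin m → Ω) {J : Type*} [Fintype J]
    (π : Fin n → Fin m → J) {ρ : J → Fin n × Λ} (hρ : Function.Injective ρ) (α β : J → ℝ)
    (hα : ∀ i j, f (X i j) = α (π i j)) (hβ : ∀ i j, f' (X i j) = β (π i j))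
    (hw : ∀ i j (η : Fin n → Λ → ℝ),
      ∑ l, w l (X i j) * η i l = η (ρ (π i j)).1 (ρ (π i j)).2)
    (hff : f' x = -f x) :
    ENNReal.ofReal (2 * f x ^ 2) ≤ designError hψ f w F x X + designError hψ f' w F x X +
      ENNReal.ofReal (f x ^ 2 / 2) + ENNReal.ofReal (2 * f x ^ 2 * (C * ∑ p, (α p - β p) ^ 2)) := by
  set T : (J → ℝ) → ℝ := fun y => F.1 (fun i j => (X i j, y (π i j))) x with hT
  have hTm : Measurable T := F.2.comp
    (f := fun y : J → ℝ => ((fun i j => (X i j, y (π i j)) : DataSet n m Ω), x)) (by fun_prop)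
  have hsel := measurePreserving_select (ι := Fin n) (Λ := Λ) hψ.law hρ
  have hdata : ∀ (g : C(Ω, ℝ)) (γ : J → ℝ), (∀ i j, g (X i j) = γ (π i j)) →
      ∀ η : Fin n → Λ → ℝ, noisyData g w X η =
        fun i j => (X i j, γ (π i j) + η (ρ (π i j)).1 (ρ (π i j)).2) := by
    intro g γ hγ η
    funext i j
    rw [noisyData, hγ, hw]
  convert hψ.two_point α β hTm (f x) using 3
  · congr 1
    · rw [designError, ← hsel.lintegral_comp
        (f := fun η => ENNReal.ofReal ((T (fun i => α i + η i) - f x) ^ 2)) (by fun_prop)]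
      refine lintegral_congr fun η => ?_
      simp only [hT, hdata f α hα]
    · rw [designError, ← hsel.lintegral_comp
        (f := fun η => ENNReal.ofReal ((T (fun i => β i + η i) + f x) ^ 2)) (by fun_prop)]
      refine lintegral_congr fun η => ?_
      simp only [hT, hdata f' β hβ, hff, sub_neg_eq_add]

/-- The two-point bound is integrated over the designs in `G`. With `h = f x` the budget is `2h² ·
3/4` from the probability of `G`, minus `h²/2`, minus `2h² · 1/4` from the mean separation, which
leaves `h²/2`. -/
lemma pointError_pair [IsProbabilityMeasure (uniformLaw Ω)] (hψ : IsRootDensity ψ a C)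
    {f f' : C(Ω, ℝ)} {w : Λ → C(Ω, ℝ)} (F : Estimator n m Ω) {x : Ω}
    {G : Set (Fin n → Fin m → Ω)} (hG : MeasurableSet G)
    (hGp : ENNReal.ofReal (3 / 4) ≤ designLaw n m Ω G) {S : (Fin n → Fin m → Ω) → ℝ}
    (hSm : Measurable S) (hS : ∀ X ∈ G, ENNReal.ofReal (2 * f x ^ 2) ≤ designError hψ f w F x X +
      designError hψ f' w F x X + ENNReal.ofReal (f x ^ 2 / 2) +
        ENNReal.ofReal (2 * f x ^ 2 * (C * S X)))
    (hSi : ∫⁻ X, ENNReal.ofReal (C * S X) ∂designLaw n m Ω ≤ ENNReal.ofReal (1 / 4)) :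
    ENNReal.ofReal (f x ^ 2 / 2) ≤ pointError hψ f w F x + pointError hψ f' w F x := by
  have : IsProbabilityMeasure (designLaw n m Ω) := by unfold designLaw; infer_instance
  have hd : ∀ g : C(Ω, ℝ), Measurable (designError hψ g w F x) := fun g =>
    (measurable_designError hψ g w F).comp measurable_prodMk_left
  have h1 : ENNReal.ofReal (2 * f x ^ 2 * (3 / 4)) ≤ pointError hψ f w F x +
      pointError hψ f' w F x + ENNReal.ofReal (f x ^ 2 / 2) + ENNReal.ofReal (f x ^ 2 / 2) := by
    calc ENNReal.ofReal (2 * f x ^ 2 * (3 / 4))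
        ≤ ENNReal.ofReal (2 * f x ^ 2) * designLaw n m Ω G := by
          rw [ENNReal.ofReal_mul (by positivity)]
          gcongr
      _ = ∫⁻ _ in G, ENNReal.ofReal (2 * f x ^ 2) ∂designLaw n m Ω := by
          rw [setLIntegral_const]
      _ ≤ ∫⁻ X in G, (designError hψ f w F x X + designError hψ f' w F x X +
            ENNReal.ofReal (f x ^ 2 / 2) +
            ENNReal.ofReal (2 * f x ^ 2) * ENNReal.ofReal (C * S X)) ∂designLaw n m Ω := by
          refine setLIntegral_mono' hG fun X hX => ?_
          rw [← ENNReal.ofReal_mul (by positivity)]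
          exact hS X hX
      _ ≤ ∫⁻ X, (designError hψ f w F x X + designError hψ f' w F x X +
            ENNReal.ofReal (f x ^ 2 / 2) +
            ENNReal.ofReal (2 * f x ^ 2) * ENNReal.ofReal (C * S X)) ∂designLaw n m Ω :=
          setLIntegral_le_lintegral _ _
      _ ≤ _ := by
          have hd1 := hd f
          have hd2 := hd f'
          rw [lintegral_add_left (by fun_prop), lintegral_add_left (by fun_prop),
            lintegral_add_left (by fun_prop), lintegral_const_mul _ (by fun_prop), lintegral_const,
            measure_univ, mul_one]
          refine add_le_add le_rfl ((mul_le_mul_right hSi _).trans (le_of_eq ?_))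
          rw [← ENNReal.ofReal_mul (by positivity)]
          congr 1
          ring
  rw [show 2 * f x ^ 2 * (3 / 4) = f x ^ 2 / 2 + f x ^ 2 / 2 + f x ^ 2 / 2 by ring,
    ENNReal.ofReal_add (by positivity) (by positivity),
    ENNReal.ofReal_add (by positivity) (by positivity)] at h1
  exact (ENNReal.add_le_add_iff_right ENNReal.ofReal_ne_top).1
    ((ENNReal.add_le_add_iff_right ENNReal.ofReal_ne_top).1 h1)

/-- The worst-case prediction error of an estimator. -/
def maxError (s L b₂ b₃ : ℝ) (F : Estimator n m Ω) : ℝ≥0∞ :=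
  ⨆ (Q : Law n m Ω) (_ : Q.Admissible s L b₂ b₃), Q.predictionError F

lemma ofReal_half_le {x : ℝ} {S : ℝ≥0∞} (h : ENNReal.ofReal x ≤ 2 * S) :
    ENNReal.ofReal (x / 2) ≤ S := by
  rw [ENNReal.ofReal_div_of_pos two_pos, ENNReal.ofReal_ofNat]
  exact ENNReal.div_le_of_le_mul' h

/-! ### The parametric rate -/

theorem ofReal_div_le_maxError [IsProbabilityMeasure (uniformLaw Ω)] {s L b₂ b₃ : ℝ} (hb₂ : 0 < b₂)
    (hψ : IsRootDensity ψ (b₂ * Real.log 2) C) {t : ℝ}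
    (htL : holderTerms d s * |t| ≤ L) (htC : 16 * C * t ^ 2 ≤ 1) (hn : 0 < n) (F : Estimator n m Ω) :
    ENNReal.ofReal (t ^ 2 / 4 * (n : ℝ)⁻¹) ≤ maxError s L b₂ b₃ F := by
  have hn1 : (1 : ℝ) ≤ n := Nat.one_le_cast.2 hn
  -- The `n` shifts differ by `2τ` each, so the separation is `n (2τ)² = 4t²`, and `htC` makes `C`
  -- times it at most `1/4`.
  set τ : ℝ := t / Real.sqrt n with hτ
  have hτ2 : τ ^ 2 = t ^ 2 / n := by rw [hτ, div_pow, Real.sq_sqrt (by linarith)]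
  have hτt : |τ| ≤ |t| := by
    rw [hτ, abs_div, abs_of_nonneg (Real.sqrt_nonneg _)]
    exact div_le_self (abs_nonneg _) (Real.one_le_sqrt.2 hn1)
  have hτL : holderTerms d s * |τ| ≤ L :=
    (mul_le_mul_of_nonneg_left hτt (Nat.cast_nonneg _)).trans htL
  -- A single constant profile: all observations of a row share the same noise variable, so the rate
  -- does not involve `m`.
  let w : Unit → C(Ω, ℝ) := fun _ => ContinuousMap.const _ 1
  have hpred : ∀ u : ℝ, |u| = |τ| → ∫⁻ x, pointError hψ (ContinuousMap.const Ω u) w F x ∂uniformLaw Ω ≤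
      maxError s L b₂ b₃ F := by
    intro u hu
    rw [← predictionError_noisyLaw]
    exact le_iSup₂ (f := fun (Q : Law n m Ω) (_ : Q.Admissible s L b₂ b₃) => Q.predictionError F)
      (noisyLaw n m hψ (ContinuousMap.const Ω u) w) (noisyLaw_admissible hb₂ hψ _ w
        (inHolderBall_const (by rwa [hu])) (by simp [w]))
  have hpair : ∀ x, ENNReal.ofReal (τ ^ 2 / 2) ≤ pointError hψ (ContinuousMap.const Ω τ) w F x +
      pointError hψ (ContinuousMap.const Ω (-τ)) w F x := by
    intro x
    have : IsProbabilityMeasure (designLaw n m Ω) := by unfold designLaw; infer_instance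
    refine pointError_pair hψ (f := ContinuousMap.const Ω τ) F MeasurableSet.univ (by
      rw [measure_univ, ENNReal.ofReal_le_one]; norm_num)
      (S := fun _ => ∑ _ : Fin n, (τ - -τ) ^ 2) measurable_const (fun X _ => ?_) ?_
    · exact designError_pair hψ (f := ContinuousMap.const Ω τ) F X (J := Fin n) (fun i _ => i)
        (ρ := fun i => (i, ())) (fun i j h => (Prod.ext_iff.1 h).1) (fun _ => τ) (fun _ => -τ)
        (fun _ _ => rfl) (fun _ _ => rfl) (fun i j η => by simp [w]) rfl
    · rw [lintegral_const, measure_univ, mul_one]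
      refine ENNReal.ofReal_le_ofReal ?_
      rw [Finset.sum_const, Finset.card_fin, nsmul_eq_mul, sub_neg_eq_add, ← two_mul, mul_pow, hτ2]
      field_simp
      linarith
  have hsum : ENNReal.ofReal (τ ^ 2 / 2) ≤ 2 * maxError s L b₂ b₃ F := by
    calc ENNReal.ofReal (τ ^ 2 / 2) = ∫⁻ _, ENNReal.ofReal (τ ^ 2 / 2) ∂uniformLaw Ω := by simp
      _ ≤ ∫⁻ x, (pointError hψ (ContinuousMap.const Ω τ) w F x +
          pointError hψ (ContinuousMap.const Ω (-τ)) w F x) ∂uniformLaw Ω := lintegral_mono hpair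
      _ ≤ _ := by
          rw [lintegral_add_left (measurable_pointError hψ _ w F), two_mul]
          exact add_le_add (hpred τ rfl) (hpred (-τ) (abs_neg τ))
  have := ofReal_half_le hsum
  rw [hτ2] at this
  refine le_trans (le_of_eq ?_) this
  congr 1
  ring

/-! ### Designs without collisions -/

lemma measurePreserving_designLaw_eval [IsProbabilityMeasure (uniformLaw Ω)] (i : Fin n)
    (j : Fin m) : MeasurePreserving (fun X : Fin n → Fin m → Ω => X i j) (designLaw n m Ω)
      (uniformLaw Ω) :=
  (measurePreserving_eval (fun _ : Fin m => uniformLaw Ω) j).comp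
    (measurePreserving_eval (fun _ : Fin n => Measure.pi fun _ : Fin m => uniformLaw Ω) i)

/-- By independence a collision has probability `∑ₗ μₗ²`, which is at most `maxₗ μₗ` because the
`μₗ` sum to `1`. -/
lemma pi_collision_le {S ι κ : Type*} [MeasurableSpace S] [Fintype ι] [Fintype κ]
    [MeasurableSpace κ] [MeasurableSingletonClass κ] (μ : Measure S) [IsProbabilityMeasure μ]
    {q : S → κ} (hq : Measurable q) {c : ℝ≥0∞} (hc : ∀ l, μ (q ⁻¹' {l}) ≤ c) {j j' : ι}
    (hj : j ≠ j') : Measure.pi (fun _ : ι => μ) {Y | q (Y j) = q (Y j')} ≤ c := by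
  classical
  have hsub : {Y : ι → S | q (Y j) = q (Y j')} ⊆
      ⋃ l : κ, (({j, j'} : Finset ι) : Set ι).pi fun _ => q ⁻¹' {l} := by
    intro Y hY
    refine Set.mem_iUnion.2 ⟨q (Y j), fun k hk => ?_⟩
    simp only [Finset.coe_insert, Finset.coe_singleton, Set.mem_insert_iff,
      Set.mem_singleton_iff] at hk
    rcases hk with rfl | rfl
    · rfl
    · exact Eq.symm hY
  refine (measure_mono hsub).trans ((measure_iUnion_fintype_le _ _).trans ?_)
  calc _ = ∑ l : κ, μ (q ⁻¹' {l}) * μ (q ⁻¹' {l}) := by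
        refine Finset.sum_congr rfl fun l _ => ?_
        rw [Measure.pi_pi_finset, Finset.prod_pair hj]
    _ ≤ ∑ l : κ, c * μ (q ⁻¹' {l}) := Finset.sum_le_sum fun l _ => by gcongr; exact hc l
    _ = c := by
        rw [← Finset.mul_sum, sum_measure_preimage_singleton _ fun l _ => hq (measurableSet_singleton l)]
        simp

/-- Designs whose points are, with respect to the coordinate `i₀`, well inside of the cells of mesh
`1 / N`, with at most one point of each row in each cell. -/
def goodDesigns (n m : ℕ) (Ω : Set (Space d)) (i₀ : Fin d) (γ : ℝ) (N : ℕ) :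
    Set (Fin n → Fin m → Ω) :=
  {X | (∀ i j, (X i j : Space d) i₀ ∉ margin γ N) ∧ ∀ i j j', j ≠ j' →
    cellIndex N ((X i j : Space d) i₀) ≠ cellIndex N ((X i j' : Space d) i₀)}

lemma measurable_cellIndex_coord (N : ℕ) (i₀ : Fin d) :
    Measurable fun x : Ω => cellIndex N ((x : Space d) i₀) :=
  (measurable_cellIndex N).comp (measurable_coord i₀)

lemma measurableSet_goodDesigns (i₀ : Fin d) (γ : ℝ) (N : ℕ) :
    MeasurableSet (goodDesigns n m Ω i₀ γ N) := by
  have hX : ∀ i j, Measurable fun X : Fin n → Fin m → Ω => X i j := fun i j => by fun_prop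
  have hset : goodDesigns n m Ω i₀ γ N =
      (⋂ i, ⋂ j, {X | (X i j : Space d) i₀ ∈ (margin γ N)ᶜ}) ∩ ⋂ i, ⋂ j, ⋂ j', ⋂ _ : j ≠ j',
        {X | cellIndex N ((X i j : Space d) i₀) = cellIndex N ((X i j' : Space d) i₀)}ᶜ := by
    ext X
    simp [goodDesigns]
  rw [hset]
  refine MeasurableSet.inter ?_ ?_
  · refine MeasurableSet.iInter fun i => MeasurableSet.iInter fun j => ?_
    exact ((measurable_coord i₀).comp (hX i j)) (measurableSet_margin γ N).compl
  · refine MeasurableSet.iInter fun i => MeasurableSet.iInter fun j => MeasurableSet.iInter fun j' =>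
      MeasurableSet.iInter fun _ => ?_
    exact (measurableSet_eq_fun ((measurable_cellIndex_coord N i₀).comp (hX i j))
      ((measurable_cellIndex_coord N i₀).comp (hX i j'))).compl

lemma uniformLaw_cell_le (hΩ : MeasurableSet Ω) (hcube : Ω ⊆ unitCube d) (hpos : 0 < volume Ω)
    (i₀ : Fin d) {N : ℕ} (hN : 0 < N) (l : Fin (N + 1)) :
    uniformLaw Ω ((fun x : Ω => cellIndex N ((x : Space d) i₀)) ⁻¹' {l}) ≤
      ENNReal.ofReal (1 / N / volume.real Ω) :=
  uniformLaw_coord_le hΩ hcube hpos i₀ _ _ measurableSet_Icc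
    (fun x hx => mem_cell hN (hcube x.2 i₀) hx) (by positivity) (volume_cell_le l)

lemma uniformLaw_margin_le (hΩ : MeasurableSet Ω) (hcube : Ω ⊆ unitCube d) (hpos : 0 < volume Ω)
    (i₀ : Fin d) {γ : ℝ} (hγ : 0 < γ) {N : ℕ} (hN : 0 < N) :
    uniformLaw Ω {x : Ω | (x : Space d) i₀ ∈ margin γ N} ≤
      ENNReal.ofReal (4 * γ / volume.real Ω) :=
  uniformLaw_coord_le hΩ hcube hpos i₀ _ _ (measurableSet_margin γ N) (fun _ hx => hx)
    (by positivity) (volume_margin_le hγ hN)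

/-- Union bound: a point near a cell boundary and a collision of two points of a row both have
probability `O(1/N)`, and for fixed `n`, `m` there are finitely many such events. -/
lemma exists_goodDesigns (n m : ℕ) (hΩ : MeasurableSet Ω) (hcube : Ω ⊆ unitCube d)
    (hpos : 0 < volume Ω) (i₀ : Fin d) : ∃ (γ : ℝ) (N : ℕ), 0 < γ ∧ γ < 1 ∧ 0 < N ∧
      ENNReal.ofReal (3 / 4) ≤ designLaw n m Ω (goodDesigns n m Ω i₀ γ N) := by
  have := isProbabilityMeasure_uniformLaw hΩ hcube hpos
  have : IsProbabilityMeasure (designLaw n m Ω) := by unfold designLaw; infer_instance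
  have hV0 : 0 < volume.real Ω :=
    ENNReal.toReal_pos hpos.ne' (measure_ne_top_of_subset_cube hcube)
  set V := volume.real Ω with hV
  -- `E` counts the bad events: `nm` for the margins and at most `nm²` for the collisions. `N > 4E /
  -- V` brings their total probability down to `1/4`.
  set E : ℕ := n * m + n * (m * m) with hE
  obtain ⟨N, hN⟩ := exists_nat_gt (4 * E / V)
  have hN0' : (0 : ℝ) < N := lt_of_le_of_lt (by positivity) hN
  have hN0 : 0 < N := Nat.cast_pos.1 hN0'
  have hN1 : (1 : ℝ) ≤ N := Nat.one_le_cast.2 hN0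
  set δ : ℝ≥0∞ := ENNReal.ofReal (1 / N / V) with hδ
  -- With `γ = 1 / (4N)` the margin bound `4γ / V` equals the collision bound `δ`.
  refine ⟨1 / (4 * N), N, by positivity, by rw [div_lt_one (by positivity)]; linarith, hN0, ?_⟩
  set G := goodDesigns n m Ω i₀ (1 / (4 * N)) N with hG
  have hsub : Gᶜ ⊆ (⋃ i : Fin n, ⋃ j : Fin m, {X | (X i j : Space d) i₀ ∈ margin (1 / (4 * N)) N}) ∪
      ⋃ i : Fin n, ⋃ j : Fin m, ⋃ j' : Fin m, {X | j ≠ j' ∧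
        cellIndex N ((X i j : Space d) i₀) = cellIndex N ((X i j' : Space d) i₀)} := by
    intro X hX
    by_contra h
    simp only [Set.mem_union, Set.mem_iUnion, Set.mem_ofPred_eq, not_or, not_exists, not_and] at h
    exact hX h
  have h1 : ∀ (i : Fin n) (j : Fin m),
      designLaw n m Ω {X | (X i j : Space d) i₀ ∈ margin (1 / (4 * N)) N} ≤ δ := by
    intro i j
    have hpre := (measurePreserving_designLaw_eval (n := n) (m := m) (Ω := Ω) i j).measure_preimage
      (s := {x : Ω | (x : Space d) i₀ ∈ margin (1 / (4 * N)) N})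
      ((measurable_coord i₀) (measurableSet_margin _ N)).nullMeasurableSet
    refine hpre.le.trans ((uniformLaw_margin_le hΩ hcube hpos i₀ (by positivity) hN0).trans
      (le_of_eq ?_))
    rw [hδ, ← hV]
    congr 1
    field_simp
  have h2 : ∀ (i : Fin n) (j j' : Fin m), designLaw n m Ω {X | j ≠ j' ∧
        cellIndex N ((X i j : Space d) i₀) = cellIndex N ((X i j' : Space d) i₀)} ≤ δ := by
    intro i j j'
    by_cases hj : j = j'
    · simp [hj]
    have hq := measurable_cellIndex_coord (Ω := Ω) N i₀
    have hpre := (measurePreserving_eval (fun _ : Fin n => Measure.pi fun _ : Fin m => uniformLaw Ω)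
      i).measure_preimage
      (s := {Y : Fin m → Ω | cellIndex N ((Y j : Space d) i₀) = cellIndex N ((Y j' : Space d) i₀)})
      (measurableSet_eq_fun (hq.comp (measurable_pi_apply j))
        (hq.comp (measurable_pi_apply j'))).nullMeasurableSet
    have hset : {X : Fin n → Fin m → Ω | j ≠ j' ∧
        cellIndex N ((X i j : Space d) i₀) = cellIndex N ((X i j' : Space d) i₀)} =
        Function.eval i ⁻¹'
          {Y : Fin m → Ω | cellIndex N ((Y j : Space d) i₀) = cellIndex N ((Y j' : Space d) i₀)} := by
      ext X
      simp [hj]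
    rw [hset]
    exact hpre.le.trans (pi_collision_le (uniformLaw Ω) hq
      (fun l => uniformLaw_cell_le hΩ hcube hpos i₀ hN0 l) hj)
  have hbad : designLaw n m Ω Gᶜ ≤ ENNReal.ofReal (1 / 4) := by
    calc designLaw n m Ω Gᶜ ≤ ∑ i : Fin n, ∑ j : Fin m, δ +
          ∑ i : Fin n, ∑ j : Fin m, ∑ j' : Fin m, δ := by
          refine (measure_mono hsub).trans ((measure_union_le _ _).trans (add_le_add ?_ ?_))
          · refine (measure_iUnion_fintype_le _ _).trans (Finset.sum_le_sum fun i _ => ?_)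
            exact (measure_iUnion_fintype_le _ _).trans (Finset.sum_le_sum fun j _ => h1 i j)
          · refine (measure_iUnion_fintype_le _ _).trans (Finset.sum_le_sum fun i _ => ?_)
            refine (measure_iUnion_fintype_le _ _).trans (Finset.sum_le_sum fun j _ => ?_)
            exact (measure_iUnion_fintype_le _ _).trans (Finset.sum_le_sum fun j' _ => h2 i j j')
      _ = (E : ℝ≥0∞) * δ := by
          simp only [Finset.sum_const, Finset.card_univ, Fintype.card_fin, nsmul_eq_mul, hE]
          push_cast
          ring
      _ ≤ _ := by
          rw [hδ, ← ENNReal.ofReal_natCast, ← ENNReal.ofReal_mul (Nat.cast_nonneg _)]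
          refine ENNReal.ofReal_le_ofReal ?_
          rw [div_lt_iff₀ hV0] at hN
          rw [div_div, mul_one_div, div_le_div_iff₀ (by positivity) (by norm_num)]
          linarith
  have h3 := prob_add_prob_compl (μ := designLaw n m Ω) (s := G)
    (measurableSet_goodDesigns i₀ _ N)
  have h4 : ENNReal.ofReal (3 / 4) + ENNReal.ofReal (1 / 4) = 1 := by
    rw [← ENNReal.ofReal_add (by norm_num) (by norm_num)]
    norm_num
  refine (ENNReal.add_le_add_iff_right (a := ENNReal.ofReal (1 / 4)) ENNReal.ofReal_ne_top).1 ?_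
  rw [h4, ← h3]
  exact add_le_add le_rfl hbad

/-! ### The nonparametric rate -/

/-- The noise profiles `x ↦ plateau γ (N x_{i₀} - l)`. -/
def cellProfile (Ω : Set (Space d)) (i₀ : Fin d) (γ : ℝ) (N : ℕ) (l : Fin (N + 1)) : C(Ω, ℝ) :=
  ⟨fun x => plateau γ (N * (x : Space d) i₀ - (l : ℕ)), by
    have := continuous_plateau γ
    fun_prop⟩

lemma sum_abs_cellProfile_le (hcube : Ω ⊆ unitCube d) (i₀ : Fin d) {γ : ℝ} (hγ : 0 < γ) (N : ℕ)
    (x : Ω) : ∑ l, |cellProfile Ω i₀ γ N l x| ≤ 1 := by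
  rw [Finset.sum_eq_single (cellIndex N ((x : Space d) i₀))]
  · exact (abs_of_nonneg (plateau_nonneg _ _)).trans_le (plateau_le_one _ _)
  · intro l _ hl
    exact abs_eq_zero.2 (plateau_sub_eq_zero_of_ne hγ (hcube x.2 i₀) hl)
  · simp

lemma sum_cellProfile_mul (hcube : Ω ⊆ unitCube d) (i₀ : Fin d) {γ : ℝ} (hγ : 0 < γ) (hγ1 : γ < 1)
    {N : ℕ} (hN : 0 < N) {x : Ω} (hx : (x : Space d) i₀ ∉ margin γ N) (η : Fin (N + 1) → ℝ) :
    ∑ l, cellProfile Ω i₀ γ N l x * η l = η (cellIndex N ((x : Space d) i₀)) := by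
  rw [Finset.sum_eq_single (cellIndex N ((x : Space d) i₀))]
  · change plateau γ _ * _ = _
    rw [plateau_cellIndex_eq_one hγ hγ1 hN (hcube x.2 i₀) hx, one_mul]
  · intro l _ hl
    change plateau γ _ * _ = _
    rw [plateau_sub_eq_zero_of_ne hγ (hcube x.2 i₀) hl, zero_mul]
  · simp

/-- The signs of the bumps. -/
def boolSign (b : Bool) : ℝ := if b then 1 else -1

lemma boolSign_not (b : Bool) : boolSign (!b) = -boolSign b := by cases b <;> simp [boolSign]

lemma abs_boolSign (b : Bool) : |boolSign b| = 1 := by cases b <;> simp [boolSign]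

lemma boolSign_sq (b : Bool) : boolSign b ^ 2 = 1 := by cases b <;> simp [boolSign]

/-- The regression function with a bump of sign `ω k` in the cell `k`. -/
def bumpFunction (Ω : Set (Space d)) (γ A s : ℝ) {K : ℕ} (hK : 0 < K)
    (ω : (Fin d → Fin (K + 1)) → Bool) : C(Ω, ℝ) :=
  ⟨fun x => bumpSum γ A s K (fun k => boolSign (ω k)) 0 x,
    (continuous_bumpSum γ A s hK _ 0).comp continuous_subtype_val⟩

/-- The cell of mesh `1 / K` that contains `x`. -/
def cubeIndex (K : ℕ) (x : Ω) : Fin d → Fin (K + 1) := fun i => cellIndex K ((x : Space d) i)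

/-- The absolute value of the regression functions `bumpFunction`. -/
def bumpHeight (γ A s : ℝ) (K : ℕ) (x : Ω) : ℝ :=
  A * (K : ℝ) ^ (-s) * ∏ i, plateau γ (K * (x : Space d) i - (cellIndex K ((x : Space d) i) : ℕ))

lemma bumpFunction_apply (hcube : Ω ⊆ unitCube d) {γ A s : ℝ} (hγ : 0 < γ) {K : ℕ} (hK : 0 < K)
    (ω : (Fin d → Fin (K + 1)) → Bool) (x : Ω) :
    bumpFunction Ω γ A s hK ω x = boolSign (ω (cubeIndex K x)) * bumpHeight γ A s K x :=
  bumpSum_zero_eq hγ _ (hcube x.2)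

lemma sq_bumpHeight_le {γ A s : ℝ} {K : ℕ} (x : Ω) :
    bumpHeight γ A s K x ^ 2 ≤ A ^ 2 * ((K : ℝ) ^ (-s)) ^ 2 := by
  rw [bumpHeight, mul_pow, mul_pow]
  refine mul_le_of_le_one_right (by positivity) (pow_le_one₀
    (Finset.prod_nonneg fun _ _ => plateau_nonneg _ _)
    (Finset.prod_le_one (fun _ _ => plateau_nonneg _ _) fun _ _ => plateau_le_one _ _))

lemma measurable_cubeIndex (K : ℕ) : Measurable (cubeIndex K : Ω → Fin d → Fin (K + 1)) :=
  measurable_pi_lambda _ fun i => measurable_cellIndex_coord K i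

lemma uniformLaw_cube_le (hΩ : MeasurableSet Ω) (hcube : Ω ⊆ unitCube d) (hpos : 0 < volume Ω)
    {K : ℕ} (hK : 0 < K) (k : Fin d → Fin (K + 1)) :
    uniformLaw Ω (cubeIndex K ⁻¹' {k}) ≤ ENNReal.ofReal ((1 / K) ^ d / volume.real Ω) := by
  refine (uniformLaw_box_le hΩ hcube hpos _ _ (fun i => measurableSet_Icc)
    (fun x hx i => mem_cell hK (hcube x.2 i) (congrFun hx i)) (fun _ => 1 / K)
    (fun _ => by positivity) (fun i => volume_cell_le (k i))).trans (le_of_eq (by simp))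

/-- Each of the `d` coordinates is in the margin with probability at most `4γ / vol Ω`. The
condition on `γ` does not involve `K`, so the bumps have full height on half of `Ω` at every mesh,
even if `Ω` contains no whole cell. -/
lemma half_le_uniformLaw_plateau (hΩ : MeasurableSet Ω) (hcube : Ω ⊆ unitCube d)
    (hpos : 0 < volume Ω) {γ : ℝ} (hγ : 0 < γ) (hγV : 8 * d * γ ≤ volume.real Ω) {K : ℕ}
    (hK : 0 < K) :
    ENNReal.ofReal (1 / 2) ≤ uniformLaw Ω {x : Ω | ∀ i, (x : Space d) i ∉ margin γ K} := by
  have := isProbabilityMeasure_uniformLaw hΩ hcube hpos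
  have hV0 : 0 < volume.real Ω :=
    ENNReal.toReal_pos hpos.ne' (measure_ne_top_of_subset_cube hcube)
  have hset : {x : Ω | ∀ i, (x : Space d) i ∉ margin γ K} =
      (⋃ i, {x : Ω | (x : Space d) i ∈ margin γ K})ᶜ := by
    ext x
    simp
  have hm : MeasurableSet (⋃ i, {x : Ω | (x : Space d) i ∈ margin γ K}) :=
    MeasurableSet.iUnion fun i => (measurable_coord i) (measurableSet_margin γ K)
  have hbad : uniformLaw Ω (⋃ i, {x : Ω | (x : Space d) i ∈ margin γ K}) ≤
      ENNReal.ofReal (1 / 2) := by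
    refine (measure_iUnion_fintype_le _ _).trans ((Finset.sum_le_sum fun i _ =>
      uniformLaw_margin_le hΩ hcube hpos i hγ hK).trans ?_)
    rw [Finset.sum_const, Finset.card_fin, nsmul_eq_mul, ← ENNReal.ofReal_natCast,
      ← ENNReal.ofReal_mul (Nat.cast_nonneg _)]
    refine ENNReal.ofReal_le_ofReal ?_
    rw [mul_div_assoc', div_le_iff₀ hV0]
    linarith
  have h3 := prob_add_prob_compl (μ := uniformLaw Ω) hm
  have h4 : ENNReal.ofReal (1 / 2) + ENNReal.ofReal (1 / 2) = 1 := by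
    rw [← ENNReal.ofReal_add (by norm_num) (by norm_num)]
    norm_num
  rw [hset]
  refine (ENNReal.add_le_add_iff_left (a := ENNReal.ofReal (1 / 2)) ENNReal.ofReal_ne_top).1 ?_
  rw [h4, ← h3]
  exact add_le_add hbad le_rfl

/-- The sign vector `ω` with the sign of the cell of `x` flipped. -/
def flipAt {κ : Type*} [DecidableEq κ] (k : κ) (ω : κ → Bool) : κ → Bool :=
  Function.update ω k (!ω k)

lemma flipAt_involutive {κ : Type*} [DecidableEq κ] (k : κ) : Function.Involutive (flipAt k) := by
  intro ω
  simp [flipAt]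

/-- Flipping one sign changes the regression function only on one cell, by at most `2 A K^(-s)`. The
expected number of design points there is at most `nm K^(-d) / vol Ω`. By `hnm` and `hA`, `C` times
the mean separation is then at most `4 C A² / vol Ω ≤ 1/4`, as `pointError_pair` requires. -/
lemma pointError_flip (hΩ : MeasurableSet Ω) (hcube : Ω ⊆ unitCube d) (hpos : 0 < volume Ω)
    (hψ : IsRootDensity ψ a C) (hC : 0 < C) {γ A s : ℝ} (hγ : 0 < γ)
    (hA : 16 * C * A ^ 2 ≤ volume.real Ω) {K : ℕ} (hK : 0 < K)
    (hnm : ((n * m : ℕ) : ℝ) * (((K : ℝ) ^ (-s)) ^ 2 * (1 / K) ^ d) ≤ 1)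
    (i₀ : Fin d) {γ' : ℝ} (hγ' : 0 < γ') (hγ1 : γ' < 1) {N : ℕ} (hN : 0 < N)
    (hG : ENNReal.ofReal (3 / 4) ≤ designLaw n m Ω (goodDesigns n m Ω i₀ γ' N))
    (F : Estimator n m Ω) (x : Ω) (ω : (Fin d → Fin (K + 1)) → Bool) :
    ENNReal.ofReal (bumpHeight γ A s K x ^ 2 / 2) ≤
      pointError hψ (bumpFunction Ω γ A s hK ω) (cellProfile Ω i₀ γ' N) F x +
      pointError hψ (bumpFunction Ω γ A s hK (flipAt (cubeIndex K x) ω))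
        (cellProfile Ω i₀ γ' N) F x := by
  have := isProbabilityMeasure_uniformLaw hΩ hcube hpos
  have : IsProbabilityMeasure (designLaw n m Ω) := by unfold designLaw; infer_instance
  have hV0 : 0 < volume.real Ω :=
    ENNReal.toReal_pos hpos.ne' (measure_ne_top_of_subset_cube hcube)
  set k := cubeIndex K x with hk
  set f := bumpFunction Ω γ A s hK ω with hf
  set f' := bumpFunction Ω γ A s hK (flipAt k ω) with hf'
  have hfx : f x ^ 2 = bumpHeight γ A s K x ^ 2 := by
    rw [hf, bumpFunction_apply hcube hγ, mul_pow, boolSign_sq, one_mul]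
  have hff : f' x = -f x := by
    rw [hf, hf', bumpFunction_apply hcube hγ, bumpFunction_apply hcube hγ, ← hk, flipAt,
      Function.update_self, boolSign_not, neg_mul]
  have hdiff : ∀ y : Ω, ENNReal.ofReal (C * (f y - f' y) ^ 2) ≤
      (cubeIndex K ⁻¹' {k}).indicator
        (fun _ => ENNReal.ofReal (4 * C * A ^ 2 * ((K : ℝ) ^ (-s)) ^ 2)) y := by
    intro y
    by_cases hy : cubeIndex K y = k
    · rw [Set.indicator_of_mem (by exact hy)]
      refine ENNReal.ofReal_le_ofReal ?_
      have : f y - f' y = 2 * (boolSign (ω k) * bumpHeight γ A s K y) := by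
        rw [hf, hf', bumpFunction_apply hcube hγ, bumpFunction_apply hcube hγ, hy, flipAt,
          Function.update_self, boolSign_not]
        ring
      rw [this, mul_pow, mul_pow, boolSign_sq]
      have := sq_bumpHeight_le (γ := γ) (A := A) (s := s) (K := K) y
      nlinarith
    · have : f y = f' y := by
        rw [hf, hf', bumpFunction_apply hcube hγ, bumpFunction_apply hcube hγ, flipAt,
          Function.update_of_ne hy]
      simp [this]
  have hfm := f.continuous.measurable
  have hfm' := f'.continuous.measurable
  rw [← hfx]
  refine pointError_pair hψ F (measurableSet_goodDesigns i₀ γ' N) hG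
    (S := fun X => ∑ p : Fin n × Fin m, (f (X p.1 p.2) - f' (X p.1 p.2)) ^ 2) (by fun_prop)
    (fun X hX => ?_) ?_
  -- On a good design every observation has its own noise variable, in its row and in the slab of
  -- its point; absence of collisions is exactly the injectivity of `ρ`.
  · refine designError_pair hψ F X (J := Fin n × Fin m) (fun i j => (i, j))
      (ρ := fun p => (p.1, cellIndex N ((X p.1 p.2 : Space d) i₀))) ?_
      (fun p => f (X p.1 p.2)) (fun p => f' (X p.1 p.2)) (fun _ _ => rfl) (fun _ _ => rfl)
      (fun i j η => sum_cellProfile_mul hcube i₀ hγ' hγ1 hN (hX.1 i j) (η i)) hff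
    rintro ⟨i, j⟩ ⟨i', j'⟩ h
    obtain ⟨h1, h2⟩ := Prod.ext_iff.1 h
    simp only at h1 h2
    subst h1
    by_contra hne
    exact hX.2 i j j' (fun hj => hne (by rw [hj])) h2
  · have hsum : ∀ X : Fin n → Fin m → Ω,
        ENNReal.ofReal (C * ∑ p : Fin n × Fin m, (f (X p.1 p.2) - f' (X p.1 p.2)) ^ 2) =
        ∑ p : Fin n × Fin m, ENNReal.ofReal (C * (f (X p.1 p.2) - f' (X p.1 p.2)) ^ 2) := by
      intro X
      rw [Finset.mul_sum, ENNReal.ofReal_sum_of_nonneg fun _ _ => by positivity]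
    simp_rw [hsum]
    rw [lintegral_finsetSum _ (fun p _ => by fun_prop)]
    calc _ ≤ ∑ p : Fin n × Fin m, ENNReal.ofReal (4 * C * A ^ 2 * ((K : ℝ) ^ (-s)) ^ 2) *
          ENNReal.ofReal ((1 / K) ^ d / volume.real Ω) := by
          refine Finset.sum_le_sum fun p _ => ?_
          rw [(measurePreserving_designLaw_eval p.1 p.2).lintegral_comp
            (f := fun y => ENNReal.ofReal (C * (f y - f' y) ^ 2)) (by fun_prop)]
          refine (lintegral_mono hdiff).trans ?_
          rw [lintegral_indicator_const (measurable_cubeIndex K (measurableSet_singleton k))]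
          gcongr
          exact uniformLaw_cube_le hΩ hcube hpos hK k
      _ ≤ _ := by
          rw [Finset.sum_const, nsmul_eq_mul, Finset.card_univ, Fintype.card_prod, Fintype.card_fin,
            Fintype.card_fin, ← ENNReal.ofReal_natCast, ← ENNReal.ofReal_mul (by positivity),
            ← ENNReal.ofReal_mul (Nat.cast_nonneg _)]
          refine ENNReal.ofReal_le_ofReal ?_
          have e : ((n * m : ℕ) : ℝ) * (4 * C * A ^ 2 * ((K : ℝ) ^ (-s)) ^ 2 *
              ((1 / K) ^ d / volume.real Ω)) =
              4 * C * A ^ 2 * (((n * m : ℕ) : ℝ) * (((K : ℝ) ^ (-s)) ^ 2 * (1 / K) ^ d)) /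
                volume.real Ω := by ring
          rw [e, div_le_iff₀ hV0]
          have := mul_le_mul_of_nonneg_left hnm (by positivity : 0 ≤ 4 * C * A ^ 2)
          linarith

/-- Assouad's argument. -/
theorem ofReal_rpow_le_maxError (hd : 0 < d) (hΩ : MeasurableSet Ω) (hcube : Ω ⊆ unitCube d)
    (hpos : 0 < volume Ω) {s L b₂ b₃ : ℝ} (hs : 0 < s) (hb₂ : 0 < b₂)
    (hψ : IsRootDensity ψ (b₂ * Real.log 2) C) (hC : 0 < C) {γ A M : ℝ} (hγ : 0 < γ) (hγ1 : γ < 1)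
    (hγV : 8 * d * γ ≤ volume.real Ω) (hA0 : 0 ≤ A) (hA : 16 * C * A ^ 2 ≤ volume.real Ω)
    (hM0 : 0 < M) (hM : ∀ j ≤ strictFloor s + 1, ∀ t, |iteratedDeriv j (plateau γ) t| ≤ M)
    (hL : holderTerms d s * ((2 + d) * (A * (2 * M) ^ d)) ≤ L) {K : ℕ} (hK : 0 < K)
    (hnm : ((n * m : ℕ) : ℝ) * (((K : ℝ) ^ (-s)) ^ 2 * (1 / K) ^ d) ≤ 1) (F : Estimator n m Ω) :
    ENNReal.ofReal (A ^ 2 / 8 * ((K : ℝ) ^ (-s)) ^ 2) ≤ maxError s L b₂ b₃ F := by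
  classical
  have := isProbabilityMeasure_uniformLaw hΩ hcube hpos
  set i₀ : Fin d := ⟨0, hd⟩
  -- The slab width may depend on `n` and `m`: it enters the law of the paths, but not the bound.
  obtain ⟨γ', N, hγ'0, hγ'1, hN, hG⟩ := exists_goodDesigns n m hΩ hcube hpos i₀
  set w := cellProfile Ω i₀ γ' N with hw
  set Φ : ((Fin d → Fin (K + 1)) → Bool) → Ω → ℝ≥0∞ := fun ω =>
    pointError hψ (bumpFunction Ω γ A s hK ω) w F with hΦ
  have hΦm : ∀ ω, Measurable (Φ ω) := fun ω => measurable_pointError hψ _ w F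
  set W : ℕ := Fintype.card ((Fin d → Fin (K + 1)) → Bool) with hW
  have hW0 : (W : ℝ≥0∞) ≠ 0 := by
    rw [Nat.cast_ne_zero]
    exact Fintype.card_ne_zero
  have hpred : ∀ ω, ∫⁻ x, Φ ω x ∂uniformLaw Ω ≤ maxError s L b₂ b₃ F := by
    intro ω
    rw [hΦ, ← predictionError_noisyLaw]
    exact le_iSup₂ (f := fun (Q : Law n m Ω) (_ : Q.Admissible s L b₂ b₃) => Q.predictionError F)
      (noisyLaw n m hψ (bumpFunction Ω γ A s hK ω) w) (noisyLaw_admissible hb₂ hψ _ w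
        (inHolderBall_bumpSum hγ hs hA0 hM0 hM hL hK fun k => (abs_boolSign _).le)
        (sum_abs_cellProfile_le hcube i₀ hγ'0 N))
  have hsum : ∀ x : Ω, (W : ℝ≥0∞) * ENNReal.ofReal (bumpHeight γ A s K x ^ 2 / 2) ≤
      2 * ∑ ω, Φ ω x := by
    intro x
    -- For fixed `x`, flipping the sign of the cell of `x` permutes the sign vectors, so twice the
    -- sum over `ω` is a sum over flipped pairs, each bounded below by `pointError_flip`.
    have hflip : ∑ ω, Φ (flipAt (cubeIndex K x) ω) x = ∑ ω, Φ ω x :=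
      Equiv.sum_comp (flipAt_involutive (cubeIndex K x)).toPerm fun ω => Φ ω x
    rw [two_mul]
    nth_rewrite 2 [← hflip]
    rw [← Finset.sum_add_distrib, hW, ← nsmul_eq_mul, ← Finset.card_univ]
    exact Finset.card_nsmul_le_sum _ _ _ fun ω _ => pointError_flip hΩ hcube hpos hψ hC hγ hA hK hnm
      i₀ hγ'0 hγ'1 hN hG F x ω
  have hheight : ENNReal.ofReal (A ^ 2 / 4 * ((K : ℝ) ^ (-s)) ^ 2) ≤
      ∫⁻ x, ENNReal.ofReal (bumpHeight γ A s K x ^ 2 / 2) ∂uniformLaw Ω := by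
    set P : Set Ω := {x : Ω | ∀ i, (x : Space d) i ∉ margin γ K} with hP
    have hPm : MeasurableSet P := by
      have : P = ⋂ i, {x : Ω | (x : Space d) i ∈ (margin γ K)ᶜ} := by
        ext x
        simp [hP]
      rw [this]
      exact MeasurableSet.iInter fun i => (measurable_coord i) (measurableSet_margin γ K).compl
    calc ENNReal.ofReal (A ^ 2 / 4 * ((K : ℝ) ^ (-s)) ^ 2)
        = ENNReal.ofReal (A ^ 2 * ((K : ℝ) ^ (-s)) ^ 2 / 2) * ENNReal.ofReal (1 / 2) := by
          rw [← ENNReal.ofReal_mul (by positivity)]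
          congr 1
          ring
      _ ≤ ENNReal.ofReal (A ^ 2 * ((K : ℝ) ^ (-s)) ^ 2 / 2) * uniformLaw Ω P := by
          gcongr
          exact half_le_uniformLaw_plateau hΩ hcube hpos hγ hγV hK
      _ = ∫⁻ _ in P, ENNReal.ofReal (A ^ 2 * ((K : ℝ) ^ (-s)) ^ 2 / 2) ∂uniformLaw Ω := by
          rw [setLIntegral_const]
      _ ≤ ∫⁻ x in P, ENNReal.ofReal (bumpHeight γ A s K x ^ 2 / 2) ∂uniformLaw Ω := by
          refine setLIntegral_mono' hPm fun x hx => le_of_eq ?_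
          rw [bumpHeight, Finset.prod_eq_one fun i _ =>
            plateau_cellIndex_eq_one hγ hγ1 hK (hcube x.2 i) (hx i), mul_one, mul_pow]
      _ ≤ _ := setLIntegral_le_lintegral _ _
  have hfinal : (W : ℝ≥0∞) * ENNReal.ofReal (A ^ 2 / 4 * ((K : ℝ) ^ (-s)) ^ 2) ≤
      W * (2 * maxError s L b₂ b₃ F) := by
    calc _ ≤ (W : ℝ≥0∞) * ∫⁻ x, ENNReal.ofReal (bumpHeight γ A s K x ^ 2 / 2) ∂uniformLaw Ω := by
          gcongr
      _ = ∫⁻ x, (W : ℝ≥0∞) * ENNReal.ofReal (bumpHeight γ A s K x ^ 2 / 2) ∂uniformLaw Ω :=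
          (lintegral_const_mul' _ _ (ENNReal.natCast_ne_top W)).symm
      _ ≤ ∫⁻ x, 2 * ∑ ω, Φ ω x ∂uniformLaw Ω := lintegral_mono hsum
      _ = 2 * ∑ ω, ∫⁻ x, Φ ω x ∂uniformLaw Ω := by
          rw [lintegral_const_mul' _ _ (by simp), lintegral_finsetSum _ fun ω _ => hΦm ω]
      _ ≤ 2 * (W * maxError s L b₂ b₃ F) := by
          gcongr
          rw [hW, ← nsmul_eq_mul, ← Finset.card_univ]
          exact Finset.sum_le_card_nsmul _ _ _ fun ω _ => hpred ω
      _ = _ := by ring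
  have := ofReal_half_le ((ENNReal.mul_le_mul_iff_right hW0 (ENNReal.natCast_ne_top W)).1 hfinal)
  refine le_trans (le_of_eq ?_) this
  congr 1
  ring

/-! ### Choice of the constants -/

/-- `K ≍ T^(1/(2s+d))` balances the squared height `K^(-2s)` against the information `T K^(-2s-d)`
in one cell. Rounding up keeps the latter at most `1`. -/
lemma exists_mesh {s : ℝ} (hs : 0 < s) (d : ℕ) {T : ℝ} (hT : 1 ≤ T) :
    ∃ K : ℕ, 0 < K ∧ T * (((K : ℝ) ^ (-s)) ^ 2 * (1 / K) ^ d) ≤ 1 ∧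
      (2 : ℝ) ^ (-(2 * s)) * T ^ (-(2 * s) / (2 * s + d)) ≤ ((K : ℝ) ^ (-s)) ^ 2 := by
  have hD : 0 < 2 * s + d := by positivity
  set u : ℝ := T ^ (1 / (2 * s + d)) with hu
  have hu1 : 1 ≤ u := Real.one_le_rpow hT (by positivity)
  have hu0 : 0 < u := by linarith
  have huT : u ^ (2 * s + d) = T := by
    rw [hu, ← Real.rpow_mul (by linarith), one_div_mul_cancel hD.ne', Real.rpow_one]
  set K := ⌈u⌉₊ with hKdef
  have hKu : u ≤ K := Nat.le_ceil u
  -- Since `u ≥ 1`, rounding up at most doubles `u`; this is the source of the factor `2^(-2s)`.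
  have hK2 : (K : ℝ) ≤ 2 * u := by linarith [Nat.ceil_lt_add_one hu0.le]
  have hK0 : (0 : ℝ) < K := by linarith
  have hsq : ((K : ℝ) ^ (-s)) ^ 2 = (K : ℝ) ^ (-(2 * s)) := by
    rw [← Real.rpow_natCast, ← Real.rpow_mul hK0.le]
    congr 1
    push_cast
    ring
  refine ⟨K, Nat.cast_pos.1 hK0, ?_, ?_⟩
  · have e : ((K : ℝ) ^ (-s)) ^ 2 * (1 / K) ^ d = ((K : ℝ) ^ (2 * s + d))⁻¹ := by
      rw [hsq, ← Real.rpow_neg hK0.le, one_div, inv_pow, ← Real.rpow_natCast, ← Real.rpow_neg hK0.le,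
        ← Real.rpow_add hK0]
      congr 1
      ring
    rw [e, ← div_eq_mul_inv, div_le_one (by positivity), ← huT]
    exact Real.rpow_le_rpow hu0.le hKu hD.le
  · have e : T ^ (-(2 * s) / (2 * s + d)) = u ^ (-(2 * s)) := by
      rw [hu, ← Real.rpow_mul (by linarith)]
      congr 1
      ring
    rw [hsq, e, ← Real.mul_rpow two_pos.le hu0.le]
    exact Real.rpow_le_rpow_of_nonpos hK0 hK2 (by linarith)

lemma exists_small {B D L V : ℝ} (hB : 0 ≤ B) (hD : 0 < D) (hL : 0 < L) (hV : 0 < V) :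
    ∃ t : ℝ, 0 < t ∧ B * t ≤ L ∧ D * t ^ 2 ≤ V := by
  refine ⟨min (L / (B + 1)) (Real.sqrt (V / D)), by positivity, ?_, ?_⟩
  · calc _ ≤ (B + 1) * (L / (B + 1)) := by
          gcongr
          · linarith
          · exact min_le_left _ _
      _ = L := by field_simp
  · calc _ ≤ D * Real.sqrt (V / D) ^ 2 := by
          gcongr
          exact min_le_right _ _
      _ = V := by
          rw [Real.sq_sqrt (by positivity)]
          field_simp

/-- The minimax lower bound `n⁻¹ + (nm) ^ (-2s / (2s + d))`. -/
theorem exists_minimax_lower_bound (hd : 0 < d)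
    (hΩ : MeasurableSet Ω) (hΩcube : Ω ⊆ unitCube d) (hΩpos : 0 < volume Ω)
    {s L b₂ : ℝ} (b₃ : ℝ) (hs : 0 < s) (hL : 0 < L) (hb₂ : 0 < b₂) :
    ∃ c : ℝ, 0 < c ∧ ∀ n m : ℕ, 3 ≤ n * m →
      ENNReal.ofReal (c * ((n : ℝ)⁻¹ + ((n : ℝ) * (m : ℝ)) ^ (-(2 * s) / (2 * s + (d : ℝ))))) ≤
        ⨅ F : Estimator n m Ω, maxError s L b₂ b₃ F := by
  have := isProbabilityMeasure_uniformLaw hΩ hΩcube hΩpos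
  have hV0 : 0 < volume.real Ω :=
    ENNReal.toReal_pos hΩpos.ne' (measure_ne_top_of_subset_cube hΩcube)
  obtain ⟨ψ, C, hC, hψ⟩ := exists_isRootDensity (mul_pos hb₂ (Real.log_pos one_lt_two))
  have hd0 : (0 : ℝ) < d := Nat.cast_pos.2 hd
  -- The constants `γ`, `M`, `t`, `A` are all fixed before `n` and `m`, so `c` does not depend on
  -- them.
  obtain ⟨γ, hγ0, hγ1, hγV⟩ : ∃ γ : ℝ, 0 < γ ∧ γ < 1 ∧ 8 * d * γ ≤ volume.real Ω := by
    refine ⟨min (1 / 2) (volume.real Ω / (8 * d)), by positivity,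
      (min_le_left _ _).trans_lt (by norm_num), ?_⟩
    calc _ ≤ 8 * d * (volume.real Ω / (8 * d)) := by
          gcongr
          exact min_le_right _ _
      _ = volume.real Ω := by field_simp
  obtain ⟨M, hM0, hM⟩ := exists_iteratedDeriv_plateau_le hγ0 (strictFloor s + 1)
  obtain ⟨t, ht0, htL, htC⟩ := exists_small (B := holderTerms d s) (D := 16 * C)
    (Nat.cast_nonneg _) (by positivity) hL one_pos
  obtain ⟨A, hA0, hAL, hAV⟩ := exists_small (B := holderTerms d s * ((2 + d) * (2 * M) ^ d))
    (D := 16 * C) (by positivity) (by positivity) hL hV0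
  set c₁ : ℝ := t ^ 2 / 4
  set c₂ : ℝ := A ^ 2 / 8 * (2 : ℝ) ^ (-(2 * s))
  have hc₁ : 0 < c₁ := by positivity
  have hc₂ : 0 < c₂ := by positivity
  -- The worst-case error dominates each of the two rates, hence half of their sum.
  refine ⟨min c₁ c₂ / 2, by positivity, fun n m hnm => le_iInf fun F => ?_⟩
  have hn : 0 < n := Nat.pos_of_ne_zero fun h => by simp [h] at hnm
  have h1 : ENNReal.ofReal (c₁ * (n : ℝ)⁻¹) ≤ maxError s L b₂ b₃ F :=
    ofReal_div_le_maxError hb₂ hψ (by rwa [abs_of_pos ht0]) htC hn F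
  have hT : (1 : ℝ) ≤ ((n * m : ℕ) : ℝ) := Nat.one_le_cast.2 (by omega)
  obtain ⟨K, hK, hK1, hK2⟩ := exists_mesh hs d hT
  have h2 : ENNReal.ofReal (c₂ * ((n : ℝ) * m) ^ (-(2 * s) / (2 * s + d))) ≤
      maxError s L b₂ b₃ F := by
    refine le_trans (ENNReal.ofReal_le_ofReal ?_) (ofReal_rpow_le_maxError hd hΩ hΩcube hΩpos hs hb₂
      hψ hC hγ0 hγ1 hγV hA0.le hAV hM0 hM (le_trans (le_of_eq (by ring)) hAL) hK hK1 F)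
    rw [← Nat.cast_mul, mul_assoc]
    exact mul_le_mul_of_nonneg_left hK2 (by positivity)
  have hx : (0 : ℝ) ≤ (n : ℝ)⁻¹ := by positivity
  have hy : (0 : ℝ) ≤ ((n : ℝ) * m) ^ (-(2 * s) / (2 * s + d)) := by positivity
  rw [div_mul_eq_mul_div]
  refine ofReal_half_le ?_
  calc _ ≤ ENNReal.ofReal (c₁ * (n : ℝ)⁻¹ + c₂ * ((n : ℝ) * m) ^ (-(2 * s) / (2 * s + d))) := by
        refine ENNReal.ofReal_le_ofReal ?_
        rw [mul_add]
        gcongr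
        · exact min_le_left _ _
        · exact min_le_right _ _
    _ ≤ ENNReal.ofReal (c₁ * (n : ℝ)⁻¹) +
        ENNReal.ofReal (c₂ * ((n : ℝ) * m) ^ (-(2 * s) / (2 * s + d))) := ENNReal.ofReal_add_le
    _ ≤ _ := by
        rw [two_mul (maxError s L b₂ b₃ F)]
        exact add_le_add h1 h2

end RepeatedMeasurements

end

theorem theorem3 (d : ℕ) (hd : 0 < d) (Ω : Set (RepeatedMeasurements.Space d))
    (hΩ : MeasurableSet Ω) (hΩcube : Ω ⊆ RepeatedMeasurements.unitCube d) (hΩpos : 0 < volume Ω)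
    (s L b₂ b₃ : ℝ) (hs : 0 < s) (hL : 0 < L) (hb₂ : 0 < b₂) (hb₃ : 0 ≤ b₃) :
    ∃ c : ℝ, 0 < c ∧ ∀ n m : ℕ, 3 ≤ n * m →
      ENNReal.ofReal (c * ((n : ℝ)⁻¹ + ((n : ℝ) * (m : ℝ)) ^ (-(2 * s) / (2 * s + (d : ℝ))))) ≤
        ⨅ f : RepeatedMeasurements.Estimator n m Ω,
          ⨆ (Q : RepeatedMeasurements.Law n m Ω) (_ : Q.Admissible s L b₂ b₃),
            Q.predictionError f := by
  exact RepeatedMeasurements.exists_minimax_lower_bound hd hΩ hΩcube hΩpos b₃ hs hL hb₂
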